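/- Notation. Let $\mathcal V$ be the space of smooth, compactly supported, divergence-free vector fields on $\mathbb R^3$, let $H$ be its closure in $L^2(\mathbb R^3)^3$ and $V$ its closure in $H^1(\mathbb R^3)^3$. Write $(\cdot,\cdot)$ for the $L^2(\mathbb R^3)$ inner product. Let $T>0$, let $u_0\in V$, and let $u\in L^\infty(0,T;H)\cap L^2(0,T;V)$ be a Leray–Hopf weak solution on $(0,T)$ of the Navier–Stokes equations $\partial_t u+(u\cdot\nabla)u+\nabla p=\Delta u$, $\operatorname{div}u=0$, $u(0)=u_0$: that is, for all $v\in\mathcal V$ and all $\psi\in C^1(\mathbb R)$ with $\psi(T)=0$, $$-\int_0^T\psi'(t)\,(u(t),v)\,dt+\int_0^T\psi(t)\,(\nabla u,\nabla v)\,dt+\int_0^T\psi(t)\,((u\cdot\nabla)u,v)\,dt=\psi(0)\,(u_0,v),$$ and $\tfrac12\|u(t)\|_{L^2}^2+\int_0^t\|\nabla u\|_{L^2}^2\,ds\le\tfrac12\|u_0\|_{L^2}^2$ for almost every $t\in(0,T)$. Then there is $\eta\in(0,T]$ such that for every $\delta\in(0,\eta]$ and every $\omega_0\in H$ (in particular for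 $\omega_0=\operatorname{curl}u_0$) the auxiliary vorticity system on $(0,\delta)$, $$\partial_t\omega+(\bar u\cdot\nabla)\bar\omega-(\bar\omega\cdot\nabla)\bar u+\nabla q=\Delta\omega,\qquad \operatorname{div}\omega=0,\qquad \omega(0)=\omega_0,$$ $$\bar u(x)=\frac1\delta\int_0^\delta u(x,t)\,dt,\qquad \bar\omega(x)=\frac1\delta\int_0^\delta\omega(x,t)\,dt,$$ has a Leray–Hopf weak solution. That is, there is $\omega^*:[0,\delta]\to H$ such that: 1. $\omega^*\in L^2(0,\delta;V)\cap L^\infty(0,\delta;H)$; in particular $\omega^*\in L^2(0,\delta;H^1_{\rm loc})\cap L^\infty(0,\delta;L^2)$; 2. for all $v\in V$ and all $\psi\in C^1(\mathbb R)$ with $\psi(\delta)=0$, $$-\int_0^\delta\psi'(\omega^*,v)\,dt+\int_0^\delta\psi\,(\nabla\omega^*,\nabla v)\,dt+\int_0^\delta\psi\,((\bar u\cdot\nabla)\bar\omega^*,v)\,dt-\int_0^\delta\psi\,((\bar\omega^*\cdot\nabla)\bar u,v)\,dt=\psi(0)\,(\omega_0,v);$$ 3. $t\mapsto\omega^*(t)$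 is weakly continuous from $[0,\delta]$ to $L^2$, and $\omega^*(0)=\omega_0$; 4. for every $t\in[0,\delta]$, $$\tfrac12\|\omega^*(t)\|_{L^2}^2+\int_0^t\|\nabla\omega^*\|_{L^2}^2\,ds+\int_0^t\Big[((\bar u\cdot\nabla)\bar\omega^*,\omega^*)-((\bar\omega^*\cdot\nabla)\bar u,\omega^*)\Big]ds\le\tfrac12\|\omega_0\|_{L^2}^2 .$$ -/

import Mathlib

open MeasureTheory Set
open scoped ContDiff

noncomputable section

namespace NSAux

/-- Three-dimensional Euclidean space. -/
abbrev E3 : Type := EuclideanSpace ℝ (Fin 3)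

/-- The Hilbert space `L²(ℝ³; ℝ³)` of square integrable vector fields. -/
abbrev L2 : Type := Lp E3 2 (volume : Measure E3)

/-- The classical partial derivative `∂_j φ` of a vector field. -/
def pderiv (φ : E3 → E3) (j : Fin 3) (x : E3) : E3 :=
  fderiv ℝ φ x (EuclideanSpace.single j 1)

/-- The space `𝒱` of smooth compactly supported divergence-free vector fields on `ℝ³`. -/
structure IsSolenoidalTest (φ : E3 → E3) : Prop where
  smooth : ContDiff ℝ ∞ φ
  compactSupport : HasCompactSupport φ
  divFree : ∀ x, ∑ j, pderiv φ j x j = 0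

/-- `H`: the closure of `𝒱` in `L²(ℝ³; ℝ³)`. -/
def H : Set L2 :=
  closure {f | ∃ φ : E3 → E3, IsSolenoidalTest φ ∧ ⇑f =ᵐ[volume] φ}

/-- `V`: the closure of `𝒱` in `H¹(ℝ³; ℝ³)`. A field `f` of `H¹` is recorded together with its
gradient, as the pair `(f, (∂₁ f, ∂₂ f, ∂₃ f))` in `L² × (L²)³`, on which the product topology is
the `H¹` topology. Hence `(f, D) ∈ V` says that some sequence in `𝒱` converges to `f` in `L²`,
with gradients converging to `D` in `L²`; then `D` is the weak gradient of `f`. -/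
def V : Set (L2 × (Fin 3 → L2)) :=
  closure {p | ∃ φ : E3 → E3, IsSolenoidalTest φ ∧ ⇑p.1 =ᵐ[volume] φ ∧
    ∀ j, ⇑(p.2 j) =ᵐ[volume] pderiv φ j}

/-- The Dirichlet form `(∇f, ∇g) = ∑_j (∂_j f, ∂_j g)_{L²}` of two gradients. -/
def gradInner (D D' : Fin 3 → L2) : ℝ := ∑ j, inner ℝ (D j) (D' j)

/-- The convection form `((a · ∇) f, c) = ∫ ∑_j a_j ∂_j f · c dx`, where `D` is the gradient
of `f`. -/
def conv (a : L2) (D : Fin 3 → L2) (c : L2) : ℝ :=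
  ∫ x, ∑ j, (a x) j * inner ℝ (D j x) (c x)

/-- The time average `(1/δ) ∫₀^δ f(t) dt`. -/
def timeAvg {E : Type*} [NormedAddCommGroup E] [NormedSpace ℝ E] (δ : ℝ) (f : ℝ → E) : E :=
  δ⁻¹ • ∫ t in (0 : ℝ)..δ, f t

/-- `u`, with spatial gradient `Du`, is a Leray–Hopf weak solution on `(0, T)` of the
Navier–Stokes equations `∂ₜ u + (u · ∇) u + ∇p = Δu`, `div u = 0`, `u(0) = u₀`. -/
structure IsLerayHopfNS (T : ℝ) (u₀ : L2) (u : ℝ → L2) (Du : ℝ → Fin 3 → L2) : Prop where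
  memLp_top : MemLp u ⊤ (volume.restrict (Ioo 0 T))
  memLp_grad : MemLp Du 2 (volume.restrict (Ioo 0 T))
  mem_V : ∀ᵐ t ∂(volume.restrict (Ioo 0 T)), (u t, Du t) ∈ V
  weak : ∀ (v : L2) (Dv : Fin 3 → L2) (φ : E3 → E3), IsSolenoidalTest φ → ⇑v =ᵐ[volume] φ →
    (∀ j, ⇑(Dv j) =ᵐ[volume] pderiv φ j) → ∀ ψ : ℝ → ℝ, ContDiff ℝ 1 ψ → ψ T = 0 →
    -(∫ t in (0 : ℝ)..T, deriv ψ t * inner ℝ (u t) v)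
      + (∫ t in (0 : ℝ)..T, ψ t * gradInner (Du t) Dv)
      + (∫ t in (0 : ℝ)..T, ψ t * conv (u t) (Du t) v)
      = ψ 0 * inner ℝ u₀ v
  energy : ∀ᵐ t ∂(volume.restrict (Ioo 0 T)),
    1 / 2 * ‖u t‖ ^ 2 + (∫ s in (0 : ℝ)..t, gradInner (Du s) (Du s)) ≤ 1 / 2 * ‖u₀‖ ^ 2

/-- `w`, with spatial gradient `Dw`, is a Leray–Hopf weak solution on `(0, δ)` of the auxiliary
vorticity system `∂ₜ w + (ū · ∇) w̄ - (w̄ · ∇) ū + ∇q = Δw`, `div w = 0`, `w(0) = w₀`, where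
`ū` and `w̄` are the time averages over `(0, δ)` of `u` and of `w` itself. -/
structure IsLerayHopfAux (δ : ℝ) (u : ℝ → L2) (Du : ℝ → Fin 3 → L2) (w₀ : L2)
    (w : ℝ → L2) (Dw : ℝ → Fin 3 → L2) : Prop where
  mem_H : ∀ t ∈ Icc 0 δ, w t ∈ H
  memLp_top : MemLp w ⊤ (volume.restrict (Ioo 0 δ))
  memLp_grad : MemLp Dw 2 (volume.restrict (Ioo 0 δ))
  mem_V : ∀ᵐ t ∂(volume.restrict (Ioo 0 δ)), (w t, Dw t) ∈ V
  weak : ∀ (v : L2) (Dv : Fin 3 → L2), (v, Dv) ∈ V → ∀ ψ : ℝ → ℝ, ContDiff ℝ 1 ψ → ψ δ = 0 →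
    -(∫ t in (0 : ℝ)..δ, deriv ψ t * inner ℝ (w t) v)
      + (∫ t in (0 : ℝ)..δ, ψ t * gradInner (Dw t) Dv)
      + (∫ t in (0 : ℝ)..δ, ψ t * conv (timeAvg δ u) (timeAvg δ Dw) v)
      - (∫ t in (0 : ℝ)..δ, ψ t * conv (timeAvg δ w) (timeAvg δ Du) v)
      = ψ 0 * inner ℝ w₀ v
  weakly_continuous : ∀ h : L2, ContinuousOn (fun t => (inner ℝ (w t) h : ℝ)) (Icc 0 δ)
  initial : w 0 = w₀
  energy : ∀ t ∈ Icc 0 δ,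
    1 / 2 * ‖w t‖ ^ 2 + (∫ s in (0 : ℝ)..t, gradInner (Dw s) (Dw s))
      + (∫ s in (0 : ℝ)..t, (conv (timeAvg δ u) (timeAvg δ Dw) (w s)
          - conv (timeAvg δ w) (timeAvg δ Du) (w s)))
      ≤ 1 / 2 * ‖w₀‖ ^ 2

end NSAux

end

/-!
For given averages `ū`, the auxiliary system is a Stokes system with a forcing that is constant in
time and linear in the average `w̄` of the unknown. The proof has two independent parts.

**The averages of `u` stay bounded in `V`.** The energy class alone only gives
`‖∇ū‖ = o(δ^(-1/2))`, which is too weak. Since `u₀ ∈ V`, the equation may be tested with `u₀`: the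
energy inequality yields `∫₀ᵗ ‖∇u‖² ≤ (u₀ - u(t), u₀)`, and the right-hand side is the time integral
of `(∇u, ∇u₀) + ((u · ∇) u, u₀)`, which the Sobolev and Hölder inequalities bound by
`½ ∫₀ᵗ ‖∇u‖² + C t`. Hence `∫₀ᵗ ‖∇u‖² ≤ C t`, and by Jensen's inequality `‖∇ū‖` is bounded uniformly
in `δ` (`IsLerayHopfNS.exists_bounded_average`). No regularity theory for `u` is involved.

**The auxiliary system is solvable for small `δ`.** Let `ι : X → Y` be the inclusion of `V` into
`L²` and let `N` be the operator on `V` that represents the forcing. The convection terms satisfy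
`(N a, v)² ≤ K ‖a‖² ‖ι v‖ ‖v‖`, with `K` bounded uniformly in `δ`; the intermediate norm of `v`
gains a power of `δ`, so that on `(0, δ)` the forcing is absorbed by the energy
(`energy_apriori`, `energy_stability`). The equation is regularized to
`(ι†ι + ε) w' + (1 - ι†ι) w + N w̄ = 0`, a linear differential equation in `X` with bounded
coefficients, solved by the exponential and by a contraction for the average `w̄`
(`exists_isRegularizedSol`). Testing with `w'` bounds `ε ∫ ‖w'‖²`
(`IsRegularizedSol.deriv_bound`), so that the energy estimate for differences makes the regularized
solutions a Cauchy sequence in `C([0, δ]; Y)` and `L²(0, δ; X)`. Strong convergence preserves the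
weak formulation, integrated in time, and the energy inequality, including the term which is
quadratic in the solution (`exists_energy_solution`).
-/

noncomputable section

set_option maxSynthPendingDepth 3

namespace NSAux

section AbstractEquation

variable {X Y : Type*} [NormedAddCommGroup X] [InnerProductSpace ℝ X]
  [NormedAddCommGroup Y] [InnerProductSpace ℝ Y]

/-! ### The energy estimate on a short time interval -/

theorem intervalIntegral_inner [CompleteSpace X] {f : ℝ → X} {a b : ℝ}
    (hf : IntervalIntegrable f volume a b) (c : X) :
    ∫ s in a..b, inner ℝ c (f s) = inner ℝ c (∫ s in a..b, f s) :=
  (innerSL ℝ c).intervalIntegral_comp_comm hf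

theorem norm_intervalIntegral_sq_le [CompleteSpace X] {f : ℝ → X} {t : ℝ} (ht : 0 ≤ t)
    (hf : MemLp f 2 (volume.restrict (Ioc 0 t))) :
    ‖∫ s in (0 : ℝ)..t, f s‖ ^ 2 ≤ t * ∫ s in (0 : ℝ)..t, ‖f s‖ ^ 2 := by
  rcases ht.eq_or_lt with rfl | ht
  · simp
  have hsq : Integrable (fun s => ‖f s‖ ^ 2) (volume.restrict (Ioc 0 t)) :=
    hf.integrable_norm_pow (by norm_num)
  have hint : Integrable f (volume.restrict (Ioc 0 t)) := hf.integrable (by norm_num)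
  set c := ∫ s in (0 : ℝ)..t, f s with hc
  have hc' : c = ∫ s in Ioc 0 t, f s := by rw [hc, intervalIntegral.integral_of_le ht.le]
  have h1 : (∫ s in (0 : ℝ)..t, (‖f s‖ ^ 2 - (2 * t⁻¹) * inner ℝ c (f s)))
      = (∫ s in (0 : ℝ)..t, ‖f s‖ ^ 2) - 2 * t⁻¹ * ‖c‖ ^ 2 := by
    rw [intervalIntegral.integral_of_le ht.le, intervalIntegral.integral_of_le ht.le,
      integral_sub hsq ((hint.const_inner c).const_mul _), integral_const_mul,
      integral_inner hint, ← hc', real_inner_self_eq_norm_sq]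
  -- the expansion of `0 ≤ ∫ ‖f - c / t‖²`
  have h2 : (∫ s in (0 : ℝ)..t, -(t⁻¹ ^ 2 * ‖c‖ ^ 2))
      ≤ ∫ s in (0 : ℝ)..t, (‖f s‖ ^ 2 - (2 * t⁻¹) * inner ℝ c (f s)) := by
    refine intervalIntegral.integral_mono_on ht.le (by simp) ?_ ?_
    · rw [intervalIntegrable_iff_integrableOn_Ioc_of_le ht.le]
      exact hsq.sub ((hint.const_inner c).const_mul _)
    · intro s _
      have := sq_nonneg ‖f s - t⁻¹ • c‖
      rw [norm_sub_sq_real, inner_smul_right, norm_smul, mul_pow, Real.norm_eq_abs, sq_abs,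
        real_inner_comm] at this
      linarith
  rw [h1, intervalIntegral.integral_const, smul_eq_mul] at h2
  have h3 : t * ((t - 0) * -(t⁻¹ ^ 2 * ‖c‖ ^ 2)) = -‖c‖ ^ 2 := by field_simp; ring
  have h4 : t * (2 * t⁻¹ * ‖c‖ ^ 2) = 2 * ‖c‖ ^ 2 := by field_simp
  nlinarith [mul_le_mul_of_nonneg_left h2 ht.le]

theorem memLp_two_Ioc_of_continuous {F : Type*} [NormedAddCommGroup F] {f : ℝ → F} (hf : Continuous f) (a b : ℝ) :
    MemLp f 2 (volume.restrict (Ioc a b)) := by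
  obtain ⟨C, hC⟩ := (isCompact_Icc (a := a) (b := b)).exists_bound_of_continuousOn hf.continuousOn
  refine MemLp.of_bound hf.aestronglyMeasurable C ?_
  filter_upwards [ae_restrict_mem measurableSet_Ioc] with s hs
  exact hC s (Ioc_subset_Icc_self hs)

/-- The energy of a function `z` driven by a forcing `N a` that is constant in time. The hypothesis
on `N` says that testing `N a` with `v` costs a norm of `v` half way between those of `X` and `Y`;
in `L²(0, δ; X) ∩ L^∞(0, δ; Y)` such a norm gains the power of `δ` in the conclusion. -/
theorem energy_apriori [CompleteSpace X] [CompleteSpace Y] (ι : X →L[ℝ] Y) (N : X →L[ℝ] X) {K δ E : ℝ}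
    (hK : 0 ≤ K) (hδ0 : 0 < δ) (hδ : δ ≤ 1 / 12)
    (hN : ∀ a v, (inner ℝ (N a) v) ^ 2 ≤ K * ‖a‖ ^ 2 * (‖ι v‖ * ‖v‖))
    {z : ℝ → X} (hz : Continuous z) (a : X)
    (hE : ∀ t ∈ Icc 0 δ, 1 / 2 * ‖ι (z t)‖ ^ 2 + (∫ s in (0 : ℝ)..t, (‖z s‖ ^ 2 - ‖ι (z s)‖ ^ 2))
      ≤ E + |inner ℝ (N a) (∫ s in (0 : ℝ)..t, z s)|) :
    ∀ t ∈ Icc 0 δ, ‖ι (z t)‖ ^ 2 + (∫ s in (0 : ℝ)..δ, ‖z s‖ ^ 2)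
      ≤ 5 * E + 15 * (K * ‖a‖ ^ 2 * (δ * √δ)) := by
  intro t₁ ht₁
  have hcι : Continuous fun t => ι (z t) := ι.continuous.comp hz
  have hcz2 : Continuous fun t => ‖z t‖ ^ 2 := by fun_prop
  have hcι2 : Continuous fun t => ‖ι (z t)‖ ^ 2 := by fun_prop
  obtain ⟨t₀, ht₀, hmax⟩ := (isCompact_Icc (a := (0 : ℝ)) (b := δ)).exists_isMaxOn
    ⟨0, left_mem_Icc.2 hδ0.le⟩ hcι.norm.continuousOn
  set m := ‖ι (z t₀)‖ with hm
  have hm0 : 0 ≤ m := norm_nonneg _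
  set Q := ∫ s in (0 : ℝ)..δ, ‖z s‖ ^ 2 with hQ
  have hQ0 : 0 ≤ Q := intervalIntegral.integral_nonneg hδ0.le fun _ _ => by positivity
  have hle : ∀ s ∈ Icc 0 δ, ‖ι (z s)‖ ≤ m := fun s hs => hmax hs
  set κ := K * ‖a‖ ^ 2 * (δ * √δ) with hκ
  have hκ0 : 0 ≤ κ := by positivity
  have hP : 0 ≤ m ^ 2 + Q := by positivity
  -- the forcing term, by the bounds `√(δ Q)` and `δ m` for `∫ z` in `X` and in `Y`
  have hR : ∀ t ∈ Icc 0 δ, |inner ℝ (N a) (∫ s in (0 : ℝ)..t, z s)|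
      ≤ (m ^ 2 + Q) / 24 + 3 * κ := by
    intro t ht
    have h1 : ‖∫ s in (0 : ℝ)..t, z s‖ ≤ √δ * √Q := by
      rw [← Real.sqrt_mul hδ0.le]
      refine Real.le_sqrt_of_sq_le ?_
      calc _ ≤ t * ∫ s in (0 : ℝ)..t, ‖z s‖ ^ 2 := by
            refine norm_intervalIntegral_sq_le ht.1 ?_
            exact memLp_two_Ioc_of_continuous hz 0 t
        _ ≤ δ * Q := by
            refine mul_le_mul ht.2 ?_ ?_ hδ0.le
            · exact intervalIntegral.integral_mono_interval le_rfl ht.1 ht.2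
                (Filter.Eventually.of_forall fun s => by positivity)
                (hcz2.intervalIntegrable _ _)
            · exact intervalIntegral.integral_nonneg ht.1 fun _ _ => by positivity
    have h2 : ‖ι (∫ s in (0 : ℝ)..t, z s)‖ ≤ m * δ := by
      rw [← ContinuousLinearMap.intervalIntegral_comp_comm _ (hz.intervalIntegrable _ _)]
      calc _ ≤ m * |t - 0| := by
            refine intervalIntegral.norm_integral_le_of_norm_le_const fun s hs => ?_
            rw [uIoc_of_le ht.1] at hs
            exact hle s ⟨hs.1.le, hs.2.trans ht.2⟩
        _ ≤ m * δ := by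
            rw [sub_zero, abs_of_nonneg ht.1]
            exact mul_le_mul_of_nonneg_left ht.2 hm0
    refine abs_le_of_sq_le_sq ?_ (by positivity)
    calc _ ≤ K * ‖a‖ ^ 2 * ((m * δ) * (√δ * √Q)) := by
          refine (hN _ _).trans ?_
          gcongr
      _ = κ * (m * √Q) := by rw [hκ]; ring
      _ ≤ κ * ((m ^ 2 + Q) / 2) := by
          refine mul_le_mul_of_nonneg_left ?_ hκ0
          nlinarith [sq_nonneg (m - √Q), Real.sq_sqrt hQ0]
      _ ≤ ((m ^ 2 + Q) / 24 + 3 * κ) ^ 2 := by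
          nlinarith [sq_nonneg ((m ^ 2 + Q) / 24 - 3 * κ)]
  have hqt : ∀ t ∈ Icc 0 δ, (∫ s in (0 : ℝ)..t, ‖ι (z s)‖ ^ 2) ≤ δ * m ^ 2 := by
    intro t ht
    calc _ ≤ ∫ s in (0 : ℝ)..t, m ^ 2 := by
          refine intervalIntegral.integral_mono_on ht.1 (hcι2.intervalIntegrable _ _) (by simp) ?_
          intro s hs
          have := hle s ⟨hs.1, hs.2.trans ht.2⟩
          gcongr
      _ ≤ δ * m ^ 2 := by
          rw [intervalIntegral.integral_const, sub_zero, smul_eq_mul]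
          exact mul_le_mul_of_nonneg_right ht.2 (sq_nonneg m)
  have hsplit : ∀ t, (∫ s in (0 : ℝ)..t, (‖z s‖ ^ 2 - ‖ι (z s)‖ ^ 2))
      = (∫ s in (0 : ℝ)..t, ‖z s‖ ^ 2) - ∫ s in (0 : ℝ)..t, ‖ι (z s)‖ ^ 2 := fun t =>
    intervalIntegral.integral_sub (hcz2.intervalIntegrable _ _) (hcι2.intervalIntegrable _ _)
  have hδmem : δ ∈ Icc 0 δ := right_mem_Icc.2 hδ0.le
  have e1 := hE t₀ ht₀
  have e2 := hE δ hδmem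
  rw [hsplit] at e1 e2
  have e3 : 0 ≤ ∫ s in (0 : ℝ)..t₀, ‖z s‖ ^ 2 :=
    intervalIntegral.integral_nonneg ht₀.1 fun _ _ => by positivity
  have e4 : ‖ι (z t₁)‖ ^ 2 ≤ m ^ 2 := by
    have := hle t₁ ht₁
    gcongr
  have e5 : δ * m ^ 2 ≤ 1 / 12 * (m ^ 2 + Q) := by
    refine mul_le_mul hδ ?_ (sq_nonneg m) (by norm_num)
    linarith
  have e6 := sq_nonneg ‖ι (z δ)‖
  linarith [hR t₀ ht₀, hR δ hδmem, hqt t₀ ht₀, hqt δ hδmem]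

/-! ### The regularized equation -/

theorem exists_exp_flow {Z : Type*} [NormedAddCommGroup Z] [NormedSpace ℝ Z] [CompleteSpace Z]
    (M : Z →L[ℝ] Z) : ∃ E : ℝ → Z →L[ℝ] Z, ∀ p, E 0 p = p ∧
      ∀ t, HasDerivAt (fun s => E s p) (M (E t p)) t := by
  refine ⟨fun t => NormedSpace.exp (t • M), fun p => ⟨by simp, fun t => ?_⟩⟩
  simpa using (hasDerivAt_exp_smul_const' M t).clm_apply (hasDerivAt_const t p)

/-- The solution at time `t` of `w' = B g - L w`, as a linear function of `p = (w 0, g)`. It is a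
component of the exponential of a block operator on `X × X`, which keeps `g` constant. -/
theorem exists_affine_flow [CompleteSpace X] (L B : X →L[ℝ] X) :
    ∃ Φ : ℝ → X × X →L[ℝ] X, ∀ p, Φ 0 p = p.1 ∧
      ∀ t, HasDerivAt (fun s => Φ s p) (B p.2 - L (Φ t p)) t := by
  let M : X × X →L[ℝ] X × X :=
    (B ∘L ContinuousLinearMap.snd ℝ X X - L ∘L ContinuousLinearMap.fst ℝ X X).prod 0
  obtain ⟨E, hE'⟩ := exists_exp_flow M
  have hE0 : ∀ p, E 0 p = p := fun p => (hE' p).1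
  have hE : ∀ p t, HasDerivAt (fun s => E s p) (M (E t p)) t := fun p => (hE' p).2
  have hsnd : ∀ p t, (E t p).2 = p.2 := by
    intro p t
    have hd : ∀ s, HasDerivAt (fun s => (E s p).2) 0 s := fun s => (hE p s).snd
    have := is_const_of_deriv_eq_zero (fun s => (hd s).differentiableAt)
      (fun s => (hd s).deriv) t 0
    simpa [hE0] using this
  refine ⟨fun t => ContinuousLinearMap.fst ℝ X X ∘L E t, fun p => ⟨by simp [hE0], fun t => ?_⟩⟩
  have h := (ContinuousLinearMap.fst ℝ X X).hasFDerivAt.comp_hasDerivAt t (hE p t)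
  have h2 : (M (E t p)).1 = B p.2 - L (E t p).1 := by simp [M, hsnd]
  exact h.congr_deriv (by simpa using h2)

/-- The inverse of `ι†ι + ε`. -/
theorem exists_regularized_inverse [CompleteSpace X] [CompleteSpace Y] (ι : X →L[ℝ] Y) {ε : ℝ} (hε : 0 < ε) :
    ∃ B : X →L[ℝ] X, ∀ y v, inner ℝ (ι (B y)) (ι v) + ε * inner ℝ (B y) v = inner ℝ y v := by
  let f : X →L[ℝ] X := (ContinuousLinearMap.adjoint ι) ∘L ι + ε • ContinuousLinearMap.id ℝ X
  have hf : ∀ x v, inner ℝ (f x) v = inner ℝ (ι x) (ι v) + ε * inner ℝ x v := by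
    intro x v
    simp [f, inner_add_left, ContinuousLinearMap.adjoint_inner_left, inner_smul_left]
  have hu : IsUnit f := by
    refine ContinuousLinearMap.isUnit_of_forall_le_norm_inner_map f (c := ⟨ε, hε.le⟩) hε ?_
    intro x
    rw [hf, real_inner_self_eq_norm_sq, real_inner_self_eq_norm_sq, Real.norm_eq_abs]
    refine le_trans ?_ (le_abs_self _)
    change ‖x‖ ^ 2 * ε ≤ _
    nlinarith [sq_nonneg ‖ι x‖]
  obtain ⟨u, hu⟩ := hu
  refine ⟨↑u⁻¹, fun y v => ?_⟩
  rw [← hf, ← hu, ← mul_apply_eq_comp]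
  simp

/-- The energy identity of a differential equation tested with its solution. The case `ε = 0` serves
for differences of regularized solutions with distinct parameters. -/
theorem energy_balance (ι : X →L[ℝ] Y) (ε : ℝ) {z z' : ℝ → X} {ρ : ℝ → ℝ}
    (hz : ∀ t, HasDerivAt z (z' t) t) (hρ : Continuous ρ)
    (h : ∀ t, inner ℝ (ι (z' t)) (ι (z t)) + ε * inner ℝ (z' t) (z t)
      + (‖z t‖ ^ 2 - ‖ι (z t)‖ ^ 2) = ρ t) (t : ℝ) :
    1 / 2 * ‖ι (z t)‖ ^ 2 + 1 / 2 * (ε * ‖z t‖ ^ 2)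
      + (∫ s in (0 : ℝ)..t, (‖z s‖ ^ 2 - ‖ι (z s)‖ ^ 2))
      = 1 / 2 * ‖ι (z 0)‖ ^ 2 + 1 / 2 * (ε * ‖z 0‖ ^ 2) + ∫ s in (0 : ℝ)..t, ρ s := by
  have hzc : Continuous z := continuous_iff_continuousAt.2 fun t => (hz t).continuousAt
  have hq : Continuous fun s => ‖z s‖ ^ 2 - ‖ι (z s)‖ ^ 2 := by fun_prop
  have hd : ∀ s, HasDerivAt (fun s => 1 / 2 * ‖ι (z s)‖ ^ 2 + 1 / 2 * (ε * ‖z s‖ ^ 2))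
      (ρ s - (‖z s‖ ^ 2 - ‖ι (z s)‖ ^ 2)) s := by
    intro s
    have h1 := ((ι.hasFDerivAt.comp_hasDerivAt s (hz s)).norm_sq).const_mul (1 / 2 : ℝ)
    have h2 := (((hz s).norm_sq).const_mul ε).const_mul (1 / 2 : ℝ)
    refine (h1.add h2).congr_deriv ?_
    rw [← h s, real_inner_comm, real_inner_comm (z s)]
    simp only [Function.comp_apply]
    rw [real_inner_comm]
    ring
  have := intervalIntegral.integral_eq_sub_of_hasDerivAt (a := 0) (b := t) (fun s _ => hd s)
    ((hρ.sub hq).intervalIntegrable _ _)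
  rw [intervalIntegral.integral_sub (hρ.intervalIntegrable _ _) (hq.intervalIntegrable _ _)] at this
  linarith

/-- `w`, with time derivative `w'`, solves
`d/dt ((ι w, ι v) + ε (w, v)) + (w, v) - (ι w, ι v) + (N w̄, v) = 0` for all `v`, where `w̄` is
the time average of `w` over `(0, δ)`. -/
structure IsRegularizedSol (ι : X →L[ℝ] Y) (N : X →L[ℝ] X) (δ ε : ℝ) (w w' : ℝ → X) : Prop where
  hasDerivAt : ∀ t, HasDerivAt w (w' t) t
  continuous_deriv : Continuous w'
  eq : ∀ t v, inner ℝ (ι (w' t)) (ι v) + ε * inner ℝ (w' t) v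
    + (inner ℝ (w t) v - inner ℝ (ι (w t)) (ι v)) + inner ℝ (N (timeAvg δ w)) v = 0

theorem norm_timeAvg_sq_le [CompleteSpace X] {δ : ℝ} (hδ0 : 0 < δ) {z : ℝ → X}
    (hz : MemLp z 2 (volume.restrict (Ioc 0 δ))) :
    ‖timeAvg δ z‖ ^ 2 ≤ δ⁻¹ * ∫ s in (0 : ℝ)..δ, ‖z s‖ ^ 2 := by
  have := norm_intervalIntegral_sq_le hδ0.le hz
  rw [timeAvg, norm_smul, mul_pow, norm_inv, Real.norm_eq_abs, abs_of_pos hδ0]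
  calc _ ≤ δ⁻¹ ^ 2 * (δ * ∫ s in (0 : ℝ)..δ, ‖z s‖ ^ 2) := by gcongr
    _ = _ := by field_simp

/-- For a prescribed average `a` in the forcing, the equation is an affine differential equation;
the average of its solution depends on `a` by a contraction, since `δ` is small. -/
theorem exists_isRegularizedSol [CompleteSpace X] [CompleteSpace Y] (ι : X →L[ℝ] Y) (N : X →L[ℝ] X) {K δ ε : ℝ}
    (hK : 0 ≤ K) (hδ0 : 0 < δ) (hδ : δ ≤ 1 / 12) (hKδ : 60 * (K * √δ) ≤ 1)
    (hN : ∀ a v, (inner ℝ (N a) v) ^ 2 ≤ K * ‖a‖ ^ 2 * (‖ι v‖ * ‖v‖)) (hε : 0 < ε) (x : X) :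
    ∃ w w' : ℝ → X, IsRegularizedSol ι N δ ε w w' ∧ w 0 = x := by
  obtain ⟨B, hB⟩ := exists_regularized_inverse ι hε
  let L : X →L[ℝ] X := B ∘L (ContinuousLinearMap.id ℝ X - (ContinuousLinearMap.adjoint ι) ∘L ι)
  obtain ⟨Φ, hΦ⟩ := exists_affine_flow L B
  have hΦc : ∀ p, Continuous fun t => Φ t p := fun p =>
    continuous_iff_continuousAt.2 fun t => ((hΦ p).2 t).continuousAt
  have heq : ∀ p t v, inner ℝ (ι (B p.2 - L (Φ t p))) (ι v) + ε * inner ℝ (B p.2 - L (Φ t p)) v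
      + (inner ℝ (Φ t p) v - inner ℝ (ι (Φ t p)) (ι v)) = inner ℝ p.2 v := by
    intro p t v
    have h1 := hB p.2 v
    have h2 := hB (Φ t p - ContinuousLinearMap.adjoint ι (ι (Φ t p))) v
    rw [inner_sub_left (Φ t p), ContinuousLinearMap.adjoint_inner_left] at h2
    have h3 : L (Φ t p) = B (Φ t p - ContinuousLinearMap.adjoint ι (ι (Φ t p))) := by simp [L]
    rw [h3, map_sub, inner_sub_left, inner_sub_left]
    linarith
  -- the response to a fixed forcing `-N a` is a contraction of the average `a`
  let F : X → X := fun a => timeAvg δ fun t => Φ t (x, -N a)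
  have hF : ContractingWith (1 / 2) F := by
    refine ⟨by rw [← NNReal.coe_lt_coe]; norm_num, LipschitzWith.of_dist_le_mul fun a b => ?_⟩
    set c := a - b with hc
    have hdiff : F a - F b = timeAvg δ fun t => Φ t (0, -N c) := by
      simp only [F, timeAvg]
      rw [← smul_sub, ← intervalIntegral.integral_sub ((hΦc _).intervalIntegrable _ _)
        ((hΦc _).intervalIntegrable _ _)]
      congr 2; ext t
      rw [← map_sub, Prod.mk_sub_mk, sub_self, hc, map_sub]
      congr 2; abel
    set z : ℝ → X := fun t => Φ t (0, -N c) with hz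
    have hzc : Continuous z := hΦc _
    have hbal := energy_balance ι ε (z := z) (ρ := fun t => -inner ℝ (N c) (z t))
      (fun t => (hΦ (0, -N c)).2 t) (by fun_prop) (fun t => by
        have := heq (0, -N c) t (z t)
        simp only [inner_neg_left] at this
        rw [← this, ← real_inner_self_eq_norm_sq, ← real_inner_self_eq_norm_sq])
    have hz0 : z 0 = 0 := (hΦ (0, -N c)).1
    have hap := energy_apriori ι N (E := 0) hK hδ0 hδ hN hzc c (fun t ht => by
      have := hbal t
      rw [hz0] at this
      simp only [map_zero, norm_zero] at this
      rw [intervalIntegral.integral_neg, intervalIntegral_inner (hzc.intervalIntegrable _ _)] at this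
      have h2 : 0 ≤ 1 / 2 * (ε * ‖z t‖ ^ 2) := by positivity
      have h3 := neg_le_abs (inner ℝ (N c) (∫ s in (0 : ℝ)..t, z s))
      linarith) 0 (left_mem_Icc.2 hδ0.le)
    have hav := norm_timeAvg_sq_le hδ0 (memLp_two_Ioc_of_continuous hzc 0 δ)
    rw [hz0] at hap
    simp only [map_zero, norm_zero] at hap
    rw [dist_eq_norm, dist_eq_norm, ← hc, hdiff]
    refine abs_le_of_sq_le_sq' ?_ (by positivity) |>.2
    calc _ ≤ δ⁻¹ * (15 * (K * ‖c‖ ^ 2 * (δ * √δ))) := by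
          refine hav.trans ?_
          gcongr
          linarith
      _ = (15 * (K * √δ)) * ‖c‖ ^ 2 := by field_simp
      _ ≤ (1 / 4) * ‖c‖ ^ 2 := by gcongr; linarith
      _ = _ := by simp; ring
  obtain ⟨a, ha⟩ : ∃ a, F a = a := ⟨_, hF.fixedPoint_isFixedPt⟩
  refine ⟨fun t => Φ t (x, -N a), fun t => B (-N a) - L (Φ t (x, -N a)),
    ⟨(hΦ _).2, ?_, fun t v => ?_⟩, (hΦ _).1⟩
  · exact continuous_const.sub (L.continuous.comp (hΦc _))
  · have h1 := heq (x, -N a) t v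
    have h2 : timeAvg δ (fun t => Φ t (x, -N a)) = a := ha
    rw [h2, h1]
    simp

/-! ### Limits in `L²` -/

section L2Limits

variable {α : Type*} [MeasurableSpace α] {μ : Measure α}

theorem norm_toLp_two_sq {f : α → X} (hf : MemLp f 2 μ) : ‖hf.toLp f‖ ^ 2 = ∫ a, ‖f a‖ ^ 2 ∂μ := by
  rw [← real_inner_self_eq_norm_sq, L2.inner_def]
  refine integral_congr_ae ?_
  filter_upwards [hf.coeFn_toLp] with a ha
  rw [ha, real_inner_self_eq_norm_sq]

theorem tendsto_toLp_two_iff {f : ℕ → α → X} {g : α → X} (hf : ∀ n, MemLp (f n) 2 μ)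
    (hg : MemLp g 2 μ) :
    Filter.Tendsto (fun n => (hf n).toLp (f n)) Filter.atTop (nhds (hg.toLp g)) ↔
    Filter.Tendsto (fun n => ∫ a, ‖f n a - g a‖ ^ 2 ∂μ) Filter.atTop (nhds 0) := by
  have h : ∀ n, ∫ a, ‖f n a - g a‖ ^ 2 ∂μ = ‖(hf n).toLp (f n) - hg.toLp g‖ ^ 2 := by
    intro n
    rw [← MemLp.toLp_sub, norm_toLp_two_sq]
    rfl
  simp_rw [h]
  rw [tendsto_iff_norm_sub_tendsto_zero]
  constructor
  · intro h; simpa using h.pow 2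
  · intro h
    simpa using h.sqrt

theorem tendsto_integral_norm_sq {f : ℕ → α → X} {g : α → X} (hf : ∀ n, MemLp (f n) 2 μ)
    (hg : MemLp g 2 μ)
    (h : Filter.Tendsto (fun n => ∫ a, ‖f n a - g a‖ ^ 2 ∂μ) Filter.atTop (nhds 0)) :
    Filter.Tendsto (fun n => ∫ a, ‖f n a‖ ^ 2 ∂μ) Filter.atTop (nhds (∫ a, ‖g a‖ ^ 2 ∂μ)) := by
  have := (((tendsto_toLp_two_iff hf hg).2 h).norm).pow 2
  simpa only [norm_toLp_two_sq] using this

theorem exists_limit_of_cauchy_two [CompleteSpace X] {f : ℕ → α → X} (hf : ∀ n, MemLp (f n) 2 μ)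
    {b : ℕ → ℝ} (hb : Filter.Tendsto b Filter.atTop (nhds 0))
    (h : ∀ n m, n ≤ m → ∫ a, ‖f n a - f m a‖ ^ 2 ∂μ ≤ b n) :
    ∃ g : α → X, MemLp g 2 μ ∧
      Filter.Tendsto (fun n => ∫ a, ‖f n a - g a‖ ^ 2 ∂μ) Filter.atTop (nhds 0) ∧
      ∃ φ : ℕ → ℕ, StrictMono φ ∧
        ∀ᵐ a ∂μ, Filter.Tendsto (fun k => f (φ k) a) Filter.atTop (nhds (g a)) := by
  have hC : CauchySeq fun n => (hf n).toLp (f n) := by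
    refine cauchySeq_of_le_tendsto_0' (fun n => √(b n)) (fun n m hnm => ?_)
      (by simpa using hb.sqrt)
    refine Real.le_sqrt_of_sq_le ?_
    rw [dist_eq_norm, ← MemLp.toLp_sub, norm_toLp_two_sq]
    exact h n m hnm
  obtain ⟨G, hG⟩ := cauchySeq_tendsto_of_complete hC
  have hGm : MemLp G 2 μ := Lp.memLp G
  have hG' : hGm.toLp G = G := Lp.toLp_coeFn G hGm
  refine ⟨G, hGm, (tendsto_toLp_two_iff hf hGm).1 (by rwa [hG']), ?_⟩
  obtain ⟨φ, hφ, hae⟩ := (tendstoInMeasure_of_tendsto_Lp hG).exists_seq_tendsto_ae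
  refine ⟨φ, hφ, ?_⟩
  filter_upwards [hae, ae_all_iff.2 fun n => (hf n).coeFn_toLp] with a ha ha2
  simpa only [ha2] using ha

end L2Limits

/-! ### Estimates for the regularized equation -/

/-- The energy estimate when the forcing is that of the time average of `z` itself. -/
theorem energy_stability [CompleteSpace X] [CompleteSpace Y] (ι : X →L[ℝ] Y) (N : X →L[ℝ] X)
    {K δ E : ℝ} (hK : 0 ≤ K) (hδ0 : 0 < δ) (hδ : δ ≤ 1 / 12) (hKδ : 60 * (K * √δ) ≤ 1)
    (hN : ∀ a v, (inner ℝ (N a) v) ^ 2 ≤ K * ‖a‖ ^ 2 * (‖ι v‖ * ‖v‖))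
    {z : ℝ → X} (hz : Continuous z)
    (hE : ∀ t ∈ Icc 0 δ, 1 / 2 * ‖ι (z t)‖ ^ 2 + (∫ s in (0 : ℝ)..t, (‖z s‖ ^ 2 - ‖ι (z s)‖ ^ 2))
      ≤ E + |inner ℝ (N (timeAvg δ z)) (∫ s in (0 : ℝ)..t, z s)|) :
    ∀ t ∈ Icc 0 δ, ‖ι (z t)‖ ^ 2 + (∫ s in (0 : ℝ)..δ, ‖z s‖ ^ 2) ≤ 20 / 3 * E := by
  intro t ht
  have h1 := energy_apriori ι N hK hδ0 hδ hN hz (timeAvg δ z) hE t ht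
  have h2 := norm_timeAvg_sq_le hδ0 (memLp_two_Ioc_of_continuous hz 0 δ)
  set Q := ∫ s in (0 : ℝ)..δ, ‖z s‖ ^ 2
  have hQ0 : 0 ≤ Q := intervalIntegral.integral_nonneg hδ0.le fun _ _ => by positivity
  have h3 : K * ‖timeAvg δ z‖ ^ 2 * (δ * √δ) ≤ (K * √δ) * Q := by
    calc _ ≤ K * (δ⁻¹ * Q) * (δ * √δ) := by gcongr
      _ = _ := by field_simp
  have h4 : 60 * (K * √δ) * Q ≤ 1 * Q := by gcongr
  nlinarith [sq_nonneg ‖ι (z t)‖]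

namespace IsRegularizedSol

variable {ι : X →L[ℝ] Y} {N : X →L[ℝ] X} {δ ε : ℝ} {w w' : ℝ → X}

theorem continuous (h : IsRegularizedSol ι N δ ε w w') : Continuous w :=
  continuous_iff_continuousAt.2 fun t => (h.hasDerivAt t).continuousAt

theorem energy_eq [CompleteSpace X] (h : IsRegularizedSol ι N δ ε w w') (t : ℝ) :
    1 / 2 * ‖ι (w t)‖ ^ 2 + 1 / 2 * (ε * ‖w t‖ ^ 2)
      + (∫ s in (0 : ℝ)..t, (‖w s‖ ^ 2 - ‖ι (w s)‖ ^ 2))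
      = 1 / 2 * ‖ι (w 0)‖ ^ 2 + 1 / 2 * (ε * ‖w 0‖ ^ 2)
        - inner ℝ (N (timeAvg δ w)) (∫ s in (0 : ℝ)..t, w s) := by
  have hc := h.continuous
  rw [energy_balance ι ε (ρ := fun t => -inner ℝ (N (timeAvg δ w)) (w t)) h.hasDerivAt
    (by fun_prop) fun t => ?_]
  · rw [intervalIntegral.integral_neg, intervalIntegral_inner (hc.intervalIntegrable _ _)]
    ring
  · have := h.eq t (w t)
    rw [real_inner_self_eq_norm_sq, real_inner_self_eq_norm_sq] at this
    linarith

theorem weak_eq [CompleteSpace X] (h : IsRegularizedSol ι N δ ε w w') (t : ℝ) (v : X) :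
    inner ℝ (ι (w t)) (ι v) + ε * inner ℝ (∫ s in (0 : ℝ)..t, w' s) v
      + (∫ s in (0 : ℝ)..t, (inner ℝ (w s) v - inner ℝ (ι (w s)) (ι v)))
      + t * inner ℝ (N (timeAvg δ w)) v = inner ℝ (ι (w 0)) (ι v) := by
  have hc := h.continuous
  have hw : (∫ s in (0 : ℝ)..t, w' s) = w t - w 0 :=
    intervalIntegral.integral_eq_sub_of_hasDerivAt (fun s _ => h.hasDerivAt s)
      (h.continuous_deriv.intervalIntegrable _ _)
  have hd : ∀ s, HasDerivAt (fun s => inner ℝ (ι (w s)) (ι v) + ε * inner ℝ (w s) v)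
      (-(inner ℝ (w s) v - inner ℝ (ι (w s)) (ι v)) - inner ℝ (N (timeAvg δ w)) v) s := by
    intro s
    have h1 := (ι.hasFDerivAt.comp_hasDerivAt s (h.hasDerivAt s)).inner ℝ (hasDerivAt_const s (ι v))
    have h2 := ((h.hasDerivAt s).inner ℝ (hasDerivAt_const s v)).const_mul ε
    refine (h1.add h2).congr_deriv ?_
    have := h.eq s v
    simp only [inner_zero_right, zero_add]
    linarith
  have hq : Continuous fun s => inner ℝ (w s) v - inner ℝ (ι (w s)) (ι v) := by fun_prop
  have := intervalIntegral.integral_eq_sub_of_hasDerivAt (a := 0) (b := t) (fun s _ => hd s)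
    ((hq.neg.sub continuous_const).intervalIntegrable _ _)
  rw [intervalIntegral.integral_sub (Continuous.intervalIntegrable (by fun_prop) _ _) (by simp),
    intervalIntegral.integral_neg, intervalIntegral.integral_const, smul_eq_mul] at this
  rw [hw, inner_sub_left]
  linarith

section Estimates

variable [CompleteSpace X] [CompleteSpace Y] {K : ℝ}

theorem bound (h : IsRegularizedSol ι N δ ε w w') (hε : 0 < ε)
    (hK : 0 ≤ K) (hδ0 : 0 < δ) (hδ : δ ≤ 1 / 12) (hKδ : 60 * (K * √δ) ≤ 1)
    (hN : ∀ a v, (inner ℝ (N a) v) ^ 2 ≤ K * ‖a‖ ^ 2 * (‖ι v‖ * ‖v‖)) :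
    ∀ t ∈ Icc 0 δ, ‖ι (w t)‖ ^ 2 + (∫ s in (0 : ℝ)..δ, ‖w s‖ ^ 2)
      ≤ 20 / 3 * (1 / 2 * ‖ι (w 0)‖ ^ 2 + 1 / 2 * (ε * ‖w 0‖ ^ 2)) := by
  refine energy_stability ι N hK hδ0 hδ hKδ hN h.continuous fun t _ => ?_
  have h1 := h.energy_eq t
  have h2 := neg_le_abs (inner ℝ (N (timeAvg δ w)) (∫ s in (0 : ℝ)..t, w s))
  have h3 : 0 ≤ 1 / 2 * (ε * ‖w t‖ ^ 2) := by positivity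
  linarith

/-- The bound from testing the equation with the time derivative of the solution; the forcing
contributes a total derivative, being constant in time. -/
theorem deriv_bound (h : IsRegularizedSol ι N δ ε w w') (hε : 0 < ε) (hε1 : ε ≤ 1)
    (hK : 0 ≤ K) (hδ0 : 0 < δ) (hδ : δ ≤ 1 / 12) (hKδ : 60 * (K * √δ) ≤ 1)
    (hN : ∀ a v, (inner ℝ (N a) v) ^ 2 ≤ K * ‖a‖ ^ 2 * (‖ι v‖ * ‖v‖)) :
    ε * (∫ s in (0 : ℝ)..δ, ‖w' s‖ ^ 2) ≤ ‖w 0‖ ^ 2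
      + (‖N‖ ^ 2 * δ⁻¹ + 1) * (20 / 3 * (1 / 2 * ‖ι (w 0)‖ ^ 2 + 1 / 2 * ‖w 0‖ ^ 2)) := by
  have hc := h.continuous
  have hc' := h.continuous_deriv
  set a := timeAvg δ w with ha
  have hd : ∀ s, HasDerivAt (fun s => 1 / 2 * (‖w s‖ ^ 2 - ‖ι (w s)‖ ^ 2) + inner ℝ (N a) (w s))
      (-(‖ι (w' s)‖ ^ 2 + ε * ‖w' s‖ ^ 2)) s := by
    intro s
    have h1 := (ι.hasFDerivAt.comp_hasDerivAt s (h.hasDerivAt s)).norm_sq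
    have h2 := (h.hasDerivAt s).norm_sq
    have h3 := (hasDerivAt_const s (N a)).inner ℝ (h.hasDerivAt s)
    refine (((h2.sub h1).const_mul (1 / 2 : ℝ)).add h3).congr_deriv ?_
    have := h.eq s (w' s)
    rw [real_inner_self_eq_norm_sq, real_inner_self_eq_norm_sq] at this
    simp only [inner_zero_left, add_zero, Function.comp_apply]
    linarith
  have hi := intervalIntegral.integral_eq_sub_of_hasDerivAt (a := 0) (b := δ) (fun s _ => hd s)
    (Continuous.intervalIntegrable (by fun_prop) _ _)
  have hmono : ε * (∫ s in (0 : ℝ)..δ, ‖w' s‖ ^ 2)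
      ≤ ∫ s in (0 : ℝ)..δ, (‖ι (w' s)‖ ^ 2 + ε * ‖w' s‖ ^ 2) := by
    rw [← intervalIntegral.integral_const_mul]
    refine intervalIntegral.integral_mono_on hδ0.le
      (Continuous.intervalIntegrable (by fun_prop) _ _)
      (Continuous.intervalIntegrable (by fun_prop) _ _) fun s _ => ?_
    linarith [sq_nonneg ‖ι (w' s)‖]
  rw [intervalIntegral.integral_neg] at hi
  have hyoung : ∀ v : X, |inner ℝ (N a) v| ≤ 1 / 2 * ‖N a‖ ^ 2 + 1 / 2 * ‖v‖ ^ 2 := fun v => by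
    linarith [abs_real_inner_le_norm (N a) v, two_mul_le_add_sq ‖N a‖ ‖v‖]
  have e1 := (neg_le_abs _).trans (hyoung (w δ))
  have e2 := (le_abs_self _).trans (hyoung (w 0))
  have e3 := h.bound hε hK hδ0 hδ hKδ hN δ (right_mem_Icc.2 hδ0.le)
  have e4 := norm_timeAvg_sq_le hδ0 (memLp_two_Ioc_of_continuous hc 0 δ)
  rw [← ha] at e4
  set B := 20 / 3 * (1 / 2 * ‖ι (w 0)‖ ^ 2 + 1 / 2 * ‖w 0‖ ^ 2) with hB
  have hQ0 : 0 ≤ ∫ s in (0 : ℝ)..δ, ‖w s‖ ^ 2 :=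
    intervalIntegral.integral_nonneg hδ0.le fun _ _ => by positivity
  have e5 : ‖ι (w δ)‖ ^ 2 + (∫ s in (0 : ℝ)..δ, ‖w s‖ ^ 2) ≤ B := by
    refine e3.trans ?_
    rw [hB]
    gcongr
    exact mul_le_of_le_one_left (sq_nonneg _) hε1
  have e6 : ‖N a‖ ^ 2 ≤ ‖N‖ ^ 2 * δ⁻¹ * B := by
    calc _ ≤ (‖N‖ * ‖a‖) ^ 2 := by gcongr; exact N.le_opNorm a
      _ = ‖N‖ ^ 2 * ‖a‖ ^ 2 := by ring
      _ ≤ ‖N‖ ^ 2 * (δ⁻¹ * B) := by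
          gcongr
          refine e4.trans ?_
          gcongr
          linarith [sq_nonneg ‖ι (w δ)‖]
      _ = _ := by ring
  nlinarith [sq_nonneg ‖ι (w 0)‖, sq_nonneg ‖ι (w δ)‖]

/-- The difference of two regularized solutions solves the equation without regularization, up to
the residual `ε₂ w₂' - ε w'`. -/
theorem sub_bound {ε₂ : ℝ} {w₂ w₂' : ℝ → X} (h : IsRegularizedSol ι N δ ε w w')
    (h₂ : IsRegularizedSol ι N δ ε₂ w₂ w₂')
    (hK : 0 ≤ K) (hδ0 : 0 < δ) (hδ : δ ≤ 1 / 12) (hKδ : 60 * (K * √δ) ≤ 1)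
    (hN : ∀ a v, (inner ℝ (N a) v) ^ 2 ≤ K * ‖a‖ ^ 2 * (‖ι v‖ * ‖v‖)) :
    ∀ t ∈ Icc 0 δ, ‖ι (w t - w₂ t)‖ ^ 2 + (∫ s in (0 : ℝ)..δ, ‖w s - w₂ s‖ ^ 2)
      ≤ 5 * ‖ι (w 0 - w₂ 0)‖ ^ 2 + 200 * (ε ^ 2 * (∫ s in (0 : ℝ)..δ, ‖w' s‖ ^ 2)
        + ε₂ ^ 2 * (∫ s in (0 : ℝ)..δ, ‖w₂' s‖ ^ 2)) := by
  have hc := h.continuous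
  have hc' := h.continuous_deriv
  have hc₂ := h₂.continuous
  have hc₂' := h₂.continuous_deriv
  set z : ℝ → X := fun t => w t - w₂ t with hz
  set r : ℝ → X := fun t => ε₂ • w₂' t - ε • w' t with hr
  have hzc : Continuous z := hc.sub hc₂
  have hrc : Continuous r := by fun_prop
  have hav : timeAvg δ z = timeAvg δ w - timeAvg δ w₂ := by
    simp only [timeAvg, hz]
    rw [intervalIntegral.integral_sub (hc.intervalIntegrable _ _) (hc₂.intervalIntegrable _ _),
      smul_sub]
  have hbal := energy_balance ι 0 (z := z)
    (ρ := fun t => inner ℝ (r t) (z t) - inner ℝ (N (timeAvg δ z)) (z t))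
    (fun t => (h.hasDerivAt t).sub (h₂.hasDerivAt t)) (by fun_prop) (fun t => by
      have e1 := h.eq t (z t)
      have e2 := h₂.eq t (z t)
      rw [hav, ← real_inner_self_eq_norm_sq, ← real_inner_self_eq_norm_sq]
      simp only [hr, hz, map_sub, inner_sub_left, real_inner_smul_left] at e1 e2 ⊢
      linarith)
  set Q := ∫ s in (0 : ℝ)..δ, ‖z s‖ ^ 2 with hQ
  set ρ := ∫ s in (0 : ℝ)..δ, ‖r s‖ ^ 2 with hρ
  have hrz : ∀ t ∈ Icc 0 δ, (∫ s in (0 : ℝ)..t, inner ℝ (r s) (z s)) ≤ 10 * ρ + 1 / 40 * Q := by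
    intro t ht
    calc _ ≤ ∫ s in (0 : ℝ)..t, (10 * ‖r s‖ ^ 2 + 1 / 40 * ‖z s‖ ^ 2) := by
          refine intervalIntegral.integral_mono_on ht.1
            (Continuous.intervalIntegrable (by fun_prop) _ _)
            (Continuous.intervalIntegrable (by fun_prop) _ _) fun s _ => ?_
          nlinarith [real_inner_le_norm (r s) (z s), sq_nonneg (20 * ‖r s‖ - ‖z s‖)]
      _ ≤ ∫ s in (0 : ℝ)..δ, (10 * ‖r s‖ ^ 2 + 1 / 40 * ‖z s‖ ^ 2) :=
          intervalIntegral.integral_mono_interval le_rfl ht.1 ht.2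
            (Filter.Eventually.of_forall fun s => by positivity)
            (Continuous.intervalIntegrable (by fun_prop) _ _)
      _ = 10 * ρ + 1 / 40 * Q := by
          rw [intervalIntegral.integral_add (Continuous.intervalIntegrable (by fun_prop) _ _)
            (Continuous.intervalIntegrable (by fun_prop) _ _),
            intervalIntegral.integral_const_mul, intervalIntegral.integral_const_mul]
  have hρle : ρ ≤ 2 * (ε ^ 2 * (∫ s in (0 : ℝ)..δ, ‖w' s‖ ^ 2)
        + ε₂ ^ 2 * (∫ s in (0 : ℝ)..δ, ‖w₂' s‖ ^ 2)) := by
    calc ρ ≤ ∫ s in (0 : ℝ)..δ, (2 * (ε ^ 2 * ‖w' s‖ ^ 2) + 2 * (ε₂ ^ 2 * ‖w₂' s‖ ^ 2)) := by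
          refine intervalIntegral.integral_mono_on hδ0.le
            (Continuous.intervalIntegrable (by fun_prop) _ _)
            (Continuous.intervalIntegrable (by fun_prop) _ _) fun s _ => ?_
          have e1 : ‖r s‖ ≤ ‖ε₂ • w₂' s‖ + ‖ε • w' s‖ := norm_sub_le _ _
          have e2 : ‖ε₂ • w₂' s‖ ^ 2 = ε₂ ^ 2 * ‖w₂' s‖ ^ 2 := by
            rw [norm_smul, mul_pow, Real.norm_eq_abs, sq_abs]
          have e3 : ‖ε • w' s‖ ^ 2 = ε ^ 2 * ‖w' s‖ ^ 2 := by
            rw [norm_smul, mul_pow, Real.norm_eq_abs, sq_abs]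
          nlinarith [norm_nonneg (r s), sq_nonneg (‖ε₂ • w₂' s‖ - ‖ε • w' s‖)]
      _ = _ := by
          rw [intervalIntegral.integral_add (Continuous.intervalIntegrable (by fun_prop) _ _)
            (Continuous.intervalIntegrable (by fun_prop) _ _)]
          simp only [intervalIntegral.integral_const_mul]
          ring
  intro t ht
  have hst := energy_stability ι N (E := 1 / 2 * ‖ι (z 0)‖ ^ 2 + (10 * ρ + 1 / 40 * Q))
    hK hδ0 hδ hKδ hN hzc (fun t ht => by
      have e1 := hbal t
      have e0 : (∫ s in (0 : ℝ)..t, (inner ℝ (r s) (z s) - inner ℝ (N (timeAvg δ z)) (z s)))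
          = (∫ s in (0 : ℝ)..t, inner ℝ (r s) (z s))
            - inner ℝ (N (timeAvg δ z)) (∫ s in (0 : ℝ)..t, z s) := by
        rw [intervalIntegral.integral_sub (Continuous.intervalIntegrable (by fun_prop) _ _)
          (Continuous.intervalIntegrable (by fun_prop) _ _),
          intervalIntegral_inner (hzc.intervalIntegrable _ _)]
      rw [e0] at e1
      have e2 := neg_le_abs (inner ℝ (N (timeAvg δ z)) (∫ s in (0 : ℝ)..t, z s))
      have e3 := hrz t ht
      linarith) t ht
  change ‖ι (z t)‖ ^ 2 + Q ≤ 5 * ‖ι (z 0)‖ ^ 2 + _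
  have hρ0 : 0 ≤ ρ := intervalIntegral.integral_nonneg hδ0.le fun _ _ => by positivity
  change ‖ι (z t)‖ ^ 2 + Q ≤ _ at hst
  linarith [sq_nonneg ‖ι (z t)‖, sq_nonneg ‖ι (z 0)‖]

end Estimates

end IsRegularizedSol

/-! ### Existence for the abstract equation -/

/-- Approximate solutions whose data converge and whose regularizing terms vanish. The parameter
`ε` is chosen after the `X`-regular approximation of `y₀`, whose norm in `X` may blow up. -/
theorem exists_approximate_sol [CompleteSpace X] [CompleteSpace Y] (ι : X →L[ℝ] Y) (N : X →L[ℝ] X) {K δ : ℝ}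
    (hK : 0 ≤ K) (hδ0 : 0 < δ) (hδ : δ ≤ 1 / 12) (hKδ : 60 * (K * √δ) ≤ 1)
    (hN : ∀ a v, (inner ℝ (N a) v) ^ 2 ≤ K * ‖a‖ ^ 2 * (‖ι v‖ * ‖v‖))
    {y₀ : Y} (hy₀ : y₀ ∈ closure (range ι)) {τ : ℝ} (hτ : 0 < τ) (hτ1 : τ ≤ 1) :
    ∃ (ε : ℝ) (w w' : ℝ → X), 0 < ε ∧ IsRegularizedSol ι N δ ε w w' ∧ ‖ι (w 0) - y₀‖ ≤ τ ∧
      ε ^ 2 * (∫ s in (0 : ℝ)..δ, ‖w' s‖ ^ 2) ≤ τ ∧ ε * ‖w 0‖ ^ 2 ≤ τ := by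
  obtain ⟨_, ⟨x, rfl⟩, hx⟩ := Metric.mem_closure_iff.1 hy₀ τ hτ
  set C := ‖x‖ ^ 2
      + (‖N‖ ^ 2 * δ⁻¹ + 1) * (20 / 3 * (1 / 2 * ‖ι x‖ ^ 2 + 1 / 2 * ‖x‖ ^ 2)) with hC
  have hC' : ‖x‖ ^ 2 ≤ C := le_add_of_nonneg_right (by positivity)
  have hC0 : 0 ≤ C := (sq_nonneg _).trans hC'
  have hε : 0 < τ / (1 + C) := by positivity
  have hε1 : τ / (1 + C) ≤ 1 := by
    rw [div_le_one (by positivity)]; linarith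
  have hεC : τ / (1 + C) * C ≤ τ := by
    rw [div_mul_eq_mul_div, div_le_iff₀ (by positivity)]; nlinarith
  obtain ⟨w, w', hw, hw0⟩ := exists_isRegularizedSol ι N hK hδ0 hδ hKδ hN hε x
  refine ⟨_, w, w', hε, hw, ?_, ?_, ?_⟩
  · rw [hw0, ← dist_eq_norm, dist_comm]; exact hx.le
  · have := hw.deriv_bound hε hε1 hK hδ0 hδ hKδ hN
    rw [hw0, ← hC] at this
    calc _ = τ / (1 + C) * (τ / (1 + C) * ∫ s in (0 : ℝ)..δ, ‖w' s‖ ^ 2) := by ring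
      _ ≤ τ / (1 + C) * C := by gcongr
      _ ≤ τ := hεC
  · rw [hw0]
    exact (mul_le_mul_of_nonneg_left hC' hε.le).trans hεC

theorem tendsto_intervalIntegral_of_two {Z : Type*} [NormedAddCommGroup Z] [InnerProductSpace ℝ Z]
    [CompleteSpace Z] {f : ℕ → ℝ → Z} {g : ℝ → Z} {t : ℝ} (ht : 0 ≤ t)
    (hf : ∀ n, MemLp (f n) 2 (volume.restrict (Ioc 0 t)))
    (hg : MemLp g 2 (volume.restrict (Ioc 0 t)))
    (h : Filter.Tendsto (fun n => ∫ s in (0 : ℝ)..t, ‖f n s - g s‖ ^ 2) Filter.atTop (nhds 0)) :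
    Filter.Tendsto (fun n => ∫ s in (0 : ℝ)..t, f n s) Filter.atTop
      (nhds (∫ s in (0 : ℝ)..t, g s)) := by
  rw [tendsto_iff_norm_sub_tendsto_zero]
  have hi : ∀ {k : ℝ → Z}, MemLp k 2 (volume.restrict (Ioc 0 t)) →
      IntervalIntegrable k volume 0 t := fun hk =>
    (intervalIntegrable_iff_integrableOn_Ioc_of_le ht).2 (hk.integrable (by norm_num))
  have h2 := (h.const_mul t).sqrt
  rw [mul_zero, Real.sqrt_zero] at h2
  refine squeeze_zero (fun _ => norm_nonneg _) (fun n => Real.le_sqrt_of_sq_le ?_) h2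
  rw [← intervalIntegral.integral_sub (hi (hf n)) (hi hg)]
  exact norm_intervalIntegral_sq_le ht ((hf n).sub hg)

/-- The solution `y`, with values in `Y`, agrees almost everywhere with a square integrable function
`Ω` with values in `X`. The equation is stated in the form integrated over `(0, t)`. -/
theorem exists_energy_solution [CompleteSpace X] [CompleteSpace Y] (ι : X →L[ℝ] Y) (N : X →L[ℝ] X) {K δ : ℝ}
    (hK : 0 ≤ K) (hδ0 : 0 < δ) (hδ : δ ≤ 1 / 12) (hKδ : 60 * (K * √δ) ≤ 1)
    (hN : ∀ a v, (inner ℝ (N a) v) ^ 2 ≤ K * ‖a‖ ^ 2 * (‖ι v‖ * ‖v‖))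
    {y₀ : Y} (hy₀ : y₀ ∈ closure (range ι)) :
    ∃ (y : ℝ → Y) (Ω : ℝ → X), Continuous y ∧ (∀ t, y t ∈ closure (range ι)) ∧
      (∃ C, ∀ t, ‖y t‖ ≤ C) ∧ MemLp Ω 2 (volume.restrict (Ioc 0 δ)) ∧
      (∀ᵐ t ∂(volume.restrict (Ioc 0 δ)), y t = ι (Ω t)) ∧ y 0 = y₀ ∧
      (∀ t ∈ Icc 0 δ, ∀ v, inner ℝ (y t) (ι v)
        + (∫ s in (0 : ℝ)..t, (inner ℝ (Ω s) v - inner ℝ (ι (Ω s)) (ι v)))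
        + t * inner ℝ (N (timeAvg δ Ω)) v = inner ℝ y₀ (ι v)) ∧
      (∀ t ∈ Icc 0 δ, 1 / 2 * ‖y t‖ ^ 2 + (∫ s in (0 : ℝ)..t, (‖Ω s‖ ^ 2 - ‖ι (Ω s)‖ ^ 2))
        + (∫ s in (0 : ℝ)..t, inner ℝ (N (timeAvg δ Ω)) (Ω s)) ≤ 1 / 2 * ‖y₀‖ ^ 2) := by
  set τ : ℕ → ℝ := fun n => 1 / ((n : ℝ) + 1) with hτ
  have hτ0 : ∀ n, 0 < τ n := fun n => by positivity
  have hτ1 : ∀ n, τ n ≤ 1 := fun n => by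
    rw [hτ]; exact (div_le_one (by positivity)).2 (by linarith [n.cast_nonneg (α := ℝ)])
  have hτanti : Antitone τ := fun n m hnm => by
    simp only [hτ]; gcongr
  have hτlim : Filter.Tendsto τ Filter.atTop (nhds 0) := tendsto_one_div_add_atTop_nhds_zero_nat
  choose ε w w' hε hw hw0 hw' hεw using fun n =>
    exists_approximate_sol ι N hK hδ0 hδ hKδ hN hy₀ (hτ0 n) (hτ1 n)
  have hwc : ∀ n, Continuous (w n) := fun n => (hw n).continuous
  have hwm : ∀ n t, MemLp (w n) 2 (volume.restrict (Ioc 0 t)) := fun n t =>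
    memLp_two_Ioc_of_continuous (hwc n) 0 t
  -- the approximate solutions form a Cauchy sequence
  set b : ℕ → ℝ := fun n => 5 * (2 * τ n) ^ 2 + 200 * (2 * τ n) with hb
  have hblim : Filter.Tendsto b Filter.atTop (nhds 0) := by
    have := (((hτlim.const_mul 2).pow 2).const_mul 5).add ((hτlim.const_mul 2).const_mul 200)
    simpa using this
  have hcauchy : ∀ n m, n ≤ m → ∀ t ∈ Icc 0 δ, ‖ι (w n t - w m t)‖ ^ 2
      + (∫ s in (0 : ℝ)..δ, ‖w n s - w m s‖ ^ 2) ≤ b n := by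
    intro n m hnm t ht
    refine ((hw n).sub_bound (hw m) hK hδ0 hδ hKδ hN t ht).trans ?_
    have e1 : ‖ι (w n 0 - w m 0)‖ ≤ 2 * τ n := by
      calc _ = ‖(ι (w n 0) - y₀) - (ι (w m 0) - y₀)‖ := by rw [map_sub]; congr 1; abel
        _ ≤ _ := norm_sub_le _ _
        _ ≤ τ n + τ m := add_le_add (hw0 n) (hw0 m)
        _ ≤ 2 * τ n := by linarith [hτanti hnm]
    have e2 : ‖ι (w n 0 - w m 0)‖ ^ 2 ≤ (2 * τ n) ^ 2 := by gcongr
    simp only [hb]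
    linarith [hw' n, hw' m, hτanti hnm]
  obtain ⟨Ω, hΩm, hΩlim, φ, hφ, hae⟩ := exists_limit_of_cauchy_two (fun n => hwm n δ) hblim
    (fun n m hnm => by
      rw [← intervalIntegral.integral_of_le hδ0.le]
      have := hcauchy n m hnm 0 (left_mem_Icc.2 hδ0.le)
      linarith [sq_nonneg ‖ι (w n 0 - w m 0)‖])
  -- uniform limit of the images in `Y`
  let G : ℕ → C(Icc (0 : ℝ) δ, Y) := fun n =>
    ⟨fun t => ι (w n t), ι.continuous.comp ((hwc n).comp continuous_subtype_val)⟩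
  have hG : CauchySeq G := by
    refine cauchySeq_of_le_tendsto_0' (fun n => √(b n)) (fun n m hnm => ?_)
      (by simpa using hblim.sqrt)
    refine (ContinuousMap.dist_le (Real.sqrt_nonneg _)).2 fun t => Real.le_sqrt_of_sq_le ?_
    have := hcauchy n m hnm t t.2
    have h0 : 0 ≤ ∫ s in (0 : ℝ)..δ, ‖w n s - w m s‖ ^ 2 :=
      intervalIntegral.integral_nonneg hδ0.le fun _ _ => by positivity
    rw [dist_eq_norm]
    change ‖ι (w n t) - ι (w m t)‖ ^ 2 ≤ _
    rw [← map_sub]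
    linarith
  obtain ⟨g, hg⟩ := cauchySeq_tendsto_of_complete hG
  have hgpt : ∀ t : Icc (0 : ℝ) δ, Filter.Tendsto (fun n => ι (w n t)) Filter.atTop (nhds (g t)) :=
    fun t => ((continuous_eval_const t).tendsto g).comp hg
  set y : ℝ → Y := IccExtend hδ0.le g with hy
  have hyt : ∀ t ∈ Icc 0 δ, Filter.Tendsto (fun n => ι (w n t)) Filter.atTop (nhds (y t)) := by
    intro t ht
    rw [hy, IccExtend_of_mem _ _ ht]
    exact hgpt ⟨t, ht⟩
  -- convergence of the terms of the equation
  have hsub : ∀ t ∈ Icc 0 δ, volume.restrict (Ioc 0 t) ≤ volume.restrict (Ioc 0 δ) := fun t ht =>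
    Measure.restrict_mono (Ioc_subset_Ioc_right ht.2) le_rfl
  have hΩmt : ∀ t ∈ Icc 0 δ, MemLp Ω 2 (volume.restrict (Ioc 0 t)) := fun t ht =>
    hΩm.mono_measure (hsub t ht)
  have hLt : ∀ t ∈ Icc 0 δ, Filter.Tendsto (fun n => ∫ s in (0 : ℝ)..t, ‖w n s - Ω s‖ ^ 2)
      Filter.atTop (nhds 0) := by
    intro t ht
    refine squeeze_zero (fun n => intervalIntegral.integral_nonneg ht.1 fun _ _ => by positivity)
      (fun n => ?_) hΩlim
    rw [intervalIntegral.integral_of_le ht.1]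
    exact integral_mono_measure (hsub t ht) (Filter.Eventually.of_forall fun s => by positivity)
      (((hwm n δ).sub hΩm).integrable_norm_pow (by norm_num))
  have hJ : ∀ t ∈ Icc 0 δ, Filter.Tendsto (fun n => ∫ s in (0 : ℝ)..t, w n s) Filter.atTop
      (nhds (∫ s in (0 : ℝ)..t, Ω s)) := fun t ht =>
    tendsto_intervalIntegral_of_two ht.1 (fun n => hwm n t) (hΩmt t ht) (hLt t ht)
  have hav : Filter.Tendsto (fun n => timeAvg δ (w n)) Filter.atTop (nhds (timeAvg δ Ω)) :=
    (hJ δ (right_mem_Icc.2 hδ0.le)).const_smul _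
  have hNav : Filter.Tendsto (fun n => N (timeAvg δ (w n))) Filter.atTop
      (nhds (N (timeAvg δ Ω))) := (N.continuous.tendsto _).comp hav
  have hint : ∀ {k : ℝ → X}, ∀ t ∈ Icc 0 δ, MemLp k 2 (volume.restrict (Ioc 0 t)) →
      IntervalIntegrable k volume 0 t := fun t ht hk =>
    (intervalIntegrable_iff_integrableOn_Ioc_of_le ht.1).2 (hk.integrable (by norm_num))
  have hlin : ∀ {k : ℝ → X}, ∀ t ∈ Icc 0 δ, MemLp k 2 (volume.restrict (Ioc 0 t)) → ∀ v,
      (∫ s in (0 : ℝ)..t, (inner ℝ (k s) v - inner ℝ (ι (k s)) (ι v)))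
        = inner ℝ v (∫ s in (0 : ℝ)..t, k s) - inner ℝ (ι v) (ι (∫ s in (0 : ℝ)..t, k s)) := by
    intro k t ht hk v
    have := (innerSL ℝ v - (innerSL ℝ (ι v)).comp ι).intervalIntegral_comp_comm (hint t ht hk)
    simpa [real_inner_comm] using this
  have hquad : ∀ {k : ℝ → X}, ∀ t ∈ Icc 0 δ, MemLp k 2 (volume.restrict (Ioc 0 t)) →
      (∫ s in (0 : ℝ)..t, (‖k s‖ ^ 2 - ‖ι (k s)‖ ^ 2))
        = (∫ s in Ioc 0 t, ‖k s‖ ^ 2) - ∫ s in Ioc 0 t, ‖ι (k s)‖ ^ 2 := by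
    intro k t ht hk
    rw [intervalIntegral.integral_of_le ht.1]
    exact integral_sub (hk.integrable_norm_pow (by norm_num))
      ((ι.comp_memLp' hk).integrable_norm_pow (by norm_num))
  refine ⟨y, Ω, g.continuous.Icc_extend', ?_, ⟨‖g‖, fun t => g.norm_coe_le_norm _⟩, hΩm, ?_, ?_,
    ?_, ?_⟩
  · intro t
    exact mem_closure_of_tendsto (hgpt (projIcc 0 δ hδ0.le t))
      (Filter.Eventually.of_forall fun n => mem_range_self _)
  · filter_upwards [hae, ae_restrict_mem measurableSet_Ioc] with t ht htm
    exact tendsto_nhds_unique ((hyt t (Ioc_subset_Icc_self htm)).comp hφ.tendsto_atTop)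
      ((ι.continuous.tendsto _).comp ht)
  · refine tendsto_nhds_unique (hyt 0 (left_mem_Icc.2 hδ0.le)) ?_
    rw [tendsto_iff_norm_sub_tendsto_zero]
    exact squeeze_zero (fun _ => norm_nonneg _) hw0 hτlim
  · intro t ht v
    have hεlim : Filter.Tendsto (fun n => ε n * inner ℝ (∫ s in (0 : ℝ)..t, w' n s) v)
        Filter.atTop (nhds 0) := by
      refine squeeze_zero_norm (fun n => ?_)
        (a := fun n => √(δ * τ n) * ‖v‖) ?_
      · rw [← real_inner_smul_left]
        refine (norm_inner_le_norm _ _).trans ?_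
        gcongr
        refine Real.le_sqrt_of_sq_le ?_
        rw [norm_smul, mul_pow, Real.norm_eq_abs, sq_abs]
        have hc' := (hw n).continuous_deriv
        calc _ ≤ ε n ^ 2 * (t * ∫ s in (0 : ℝ)..t, ‖w' n s‖ ^ 2) := by
              gcongr
              exact norm_intervalIntegral_sq_le ht.1 (memLp_two_Ioc_of_continuous hc' 0 t)
          _ ≤ ε n ^ 2 * (δ * ∫ s in (0 : ℝ)..δ, ‖w' n s‖ ^ 2) := by
              gcongr ?_ * (?_ * ?_)
              · exact intervalIntegral.integral_nonneg ht.1 fun _ _ => by positivity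
              · exact ht.2
              · exact intervalIntegral.integral_mono_interval le_rfl ht.1 ht.2
                  (Filter.Eventually.of_forall fun s => by positivity)
                  (Continuous.intervalIntegrable (by fun_prop) _ _)
          _ = δ * (ε n ^ 2 * ∫ s in (0 : ℝ)..δ, ‖w' n s‖ ^ 2) := by ring
          _ ≤ δ * τ n := by gcongr; exact hw' n
      · have := ((hτlim.const_mul δ).sqrt).mul_const ‖v‖
        simpa using this
    have h0 : Filter.Tendsto (fun n => (inner ℝ (ι (w n 0)) (ι v) : ℝ)) Filter.atTop
        (nhds (inner ℝ y₀ (ι v))) := by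
      refine Filter.Tendsto.inner ?_ tendsto_const_nhds
      rw [tendsto_iff_norm_sub_tendsto_zero]
      exact squeeze_zero (fun _ => norm_nonneg _) hw0 hτlim
    have h1 := (((hyt t ht).inner (tendsto_const_nhds (x := ι v))).add hεlim).add
      ((((tendsto_const_nhds (x := v)).inner (hJ t ht)).sub
        ((tendsto_const_nhds (x := ι v)).inner ((ι.continuous.tendsto _).comp (hJ t ht)))))
    have h2 := h1.add ((hNav.inner (tendsto_const_nhds (x := v))).const_mul t)
    rw [hlin t ht (hΩmt t ht)]
    refine tendsto_nhds_unique ?_ h0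
    rw [add_zero] at h2
    refine h2.congr fun n => ?_
    rw [← (hw n).weak_eq t v, hlin t ht (hwm n t)]
    rfl
  · intro t ht
    rw [intervalIntegral_inner (hint t ht (hΩmt t ht)), hquad t ht (hΩmt t ht)]
    have hLt' : Filter.Tendsto (fun n => ∫ s in Ioc 0 t, ‖w n s - Ω s‖ ^ 2)
        Filter.atTop (nhds 0) := by
      simpa only [intervalIntegral.integral_of_le ht.1] using hLt t ht
    have hιm : ∀ {k : ℝ → X}, MemLp k 2 (volume.restrict (Ioc 0 t)) →
        MemLp (fun s => ι (k s)) 2 (volume.restrict (Ioc 0 t)) := fun hk => ι.comp_memLp' hk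
    have hLι : Filter.Tendsto (fun n => ∫ s in Ioc 0 t, ‖ι (w n s) - ι (Ω s)‖ ^ 2)
        Filter.atTop (nhds 0) := by
      refine squeeze_zero (fun n => integral_nonneg fun _ => by positivity) (fun n => ?_)
        (by simpa using hLt'.const_mul (‖ι‖ ^ 2))
      rw [← integral_const_mul]
      refine integral_mono
        (((hιm (hwm n t)).sub (hιm (hΩmt t ht))).integrable_norm_pow (by norm_num))
        ((((hwm n t).sub (hΩmt t ht)).integrable_norm_pow (by norm_num)).const_mul _) fun s => ?_
      simp only
      rw [← map_sub, ← mul_pow]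
      gcongr
      exact ι.le_opNorm _
    have e1 := tendsto_integral_norm_sq (fun n => hwm n t) (hΩmt t ht) hLt'
    have e2 := tendsto_integral_norm_sq (fun n => hιm (hwm n t)) (hιm (hΩmt t ht)) hLι
    have e3 := ((((hyt t ht).norm.pow 2).const_mul (1 / 2 : ℝ)).add (e1.sub e2)).add
      (hNav.inner (hJ t ht))
    have e4 : Filter.Tendsto (fun n => 1 / 2 * (‖y₀‖ + τ n) ^ 2 + 1 / 2 * τ n) Filter.atTop
        (nhds (1 / 2 * ‖y₀‖ ^ 2)) := by
      have := (((tendsto_const_nhds (x := ‖y₀‖)).add hτlim).pow 2).const_mul (1 / 2 : ℝ)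
      simpa using this.add (hτlim.const_mul (1 / 2 : ℝ))
    refine le_of_tendsto_of_tendsto' e3 e4 fun n => ?_
    have e5 := (hw n).energy_eq t
    rw [hquad t ht (hwm n t)] at e5
    have e6 : ‖ι (w n 0)‖ ^ 2 ≤ (‖y₀‖ + τ n) ^ 2 := by
      have := norm_le_norm_add_norm_sub' (ι (w n 0)) y₀
      have := hw0 n
      gcongr
      linarith
    have e7 : 0 ≤ ε n * ‖w n t‖ ^ 2 := mul_nonneg (hε n).le (sq_nonneg _)
    linarith [hεw n]

end AbstractEquation

/-! ### The Hilbert space `V` -/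

theorem IsSolenoidalTest.differentiableAt {φ : E3 → E3} (h : IsSolenoidalTest φ) (x : E3) :
    DifferentiableAt ℝ φ x :=
  (h.smooth.differentiable (by simp)) x

theorem IsSolenoidalTest.zero : IsSolenoidalTest 0 where
  smooth := contDiff_const
  compactSupport := HasCompactSupport.zero
  divFree := fun x => by simp [pderiv]

theorem pderiv_add {φ χ : E3 → E3} (h : IsSolenoidalTest φ) (h' : IsSolenoidalTest χ) (j : Fin 3) :
    pderiv (φ + χ) j = pderiv φ j + pderiv χ j := by
  ext1 x
  simp [pderiv, fderiv_add (h.differentiableAt x) (h'.differentiableAt x)]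

theorem pderiv_smul {φ : E3 → E3} (h : IsSolenoidalTest φ) (c : ℝ) (j : Fin 3) :
    pderiv (c • φ) j = c • pderiv φ j := by
  ext1 x
  simp [pderiv, fderiv_const_smul (h.differentiableAt x) c]

theorem IsSolenoidalTest.add {φ χ : E3 → E3} (h : IsSolenoidalTest φ) (h' : IsSolenoidalTest χ) :
    IsSolenoidalTest (φ + χ) where
  smooth := h.smooth.add h'.smooth
  compactSupport := h.compactSupport.add h'.compactSupport
  divFree := fun x => by
    simp [pderiv_add h h', Finset.sum_add_distrib, h.divFree, h'.divFree]

theorem IsSolenoidalTest.smul {φ : E3 → E3} (h : IsSolenoidalTest φ) (c : ℝ) :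
    IsSolenoidalTest (c • φ) where
  smooth := h.smooth.const_smul c
  compactSupport := h.compactSupport.mono (Function.support_const_smul_subset c φ)
  divFree := fun x => by
    simp [pderiv_smul h, ← Finset.mul_sum, h.divFree]

/-- The pairs `(φ, ∇φ)`, for `φ` in `𝒱`, as elements of `L² × (L²)³`. -/
def testGraph : Submodule ℝ (L2 × (Fin 3 → L2)) where
  carrier := {p | ∃ φ : E3 → E3, IsSolenoidalTest φ ∧ ⇑p.1 =ᵐ[volume] φ ∧
    ∀ j, ⇑(p.2 j) =ᵐ[volume] pderiv φ j}
  zero_mem' := ⟨0, IsSolenoidalTest.zero, Lp.coeFn_zero _ _ _, fun j =>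
    (Lp.coeFn_zero _ _ _).trans (by simp [Filter.EventuallyEq, pderiv])⟩
  add_mem' := by
    rintro p q ⟨φ, hφ, h1, h2⟩ ⟨χ, hχ, h3, h4⟩
    refine ⟨φ + χ, hφ.add hχ, (Lp.coeFn_add _ _).trans (h1.add h3), fun j => ?_⟩
    rw [pderiv_add hφ hχ]
    exact (Lp.coeFn_add _ _).trans ((h2 j).add (h4 j))
  smul_mem' := by
    rintro c p ⟨φ, hφ, h1, h2⟩
    refine ⟨c • φ, hφ.smul c, (Lp.coeFn_smul _ _).trans (h1.const_smul c), fun j => ?_⟩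
    rw [pderiv_smul hφ]
    exact (Lp.coeFn_smul _ _).trans ((h2 j).const_smul c)

theorem testGraph_subset_V {p : L2 × (Fin 3 → L2)} (hp : p ∈ testGraph) : p ∈ V :=
  testGraph.le_topologicalClosure hp

/-- The space `L² × (L²)³` with its Hilbert space structure. -/
abbrev Ambient : Type := WithLp 2 (L2 × PiLp 2 (fun _ : Fin 3 => L2))

/-- The identity of `L² × (L²)³`, between its Hilbert space norm and its product norm. -/
def ambientEquiv : Ambient ≃L[ℝ] L2 × (Fin 3 → L2) :=
  (WithLp.prodContinuousLinearEquiv 2 ℝ L2 (PiLp 2 (fun _ : Fin 3 => L2))).trans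
    ((ContinuousLinearEquiv.refl ℝ L2).prodCongr
      (PiLp.continuousLinearEquiv 2 ℝ (fun _ : Fin 3 => L2)))

/-- `V` as a closed subspace of a Hilbert space; its norm is the `H¹` norm. -/
def VSub : Submodule ℝ Ambient :=
  testGraph.topologicalClosure.comap (ambientEquiv : Ambient →ₗ[ℝ] L2 × (Fin 3 → L2))

/-- The Hilbert space `V`. -/
abbrev VSp : Type := VSub

instance : CompleteSpace VSp := by
  have : IsClosed (VSub : Set Ambient) :=
    testGraph.isClosed_topologicalClosure.preimage ambientEquiv.continuous
  exact this.completeSpace_coe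

/-- The inclusion of `V` into `L²`. -/
def emb : VSp →L[ℝ] L2 :=
  ContinuousLinearMap.fst ℝ L2 (Fin 3 → L2) ∘L (ambientEquiv : Ambient →L[ℝ] _) ∘L VSub.subtypeL

/-- The gradient on `V`. -/
def grad : VSp →L[ℝ] Fin 3 → L2 :=
  ContinuousLinearMap.snd ℝ L2 (Fin 3 → L2) ∘L (ambientEquiv : Ambient →L[ℝ] _) ∘L VSub.subtypeL

theorem emb_grad_mem_V (x : VSp) : (emb x, grad x) ∈ V := x.2

/-- The element of the Hilbert space `V` given by a member of the set `V`. -/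
def toVSp (p : L2 × (Fin 3 → L2)) (hp : p ∈ V) : VSp :=
  ⟨ambientEquiv.symm p, by
    change ambientEquiv (ambientEquiv.symm p) ∈ V
    simpa using hp⟩

@[simp] theorem emb_toVSp (p : L2 × (Fin 3 → L2)) (hp : p ∈ V) : emb (toVSp p hp) = p.1 := by
  change (ambientEquiv (ambientEquiv.symm p)).1 = p.1
  simp

@[simp] theorem grad_toVSp (p : L2 × (Fin 3 → L2)) (hp : p ∈ V) : grad (toVSp p hp) = p.2 := by
  change (ambientEquiv (ambientEquiv.symm p)).2 = p.2
  simp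

theorem inner_VSp (x y : VSp) :
    inner ℝ x y = inner ℝ (emb x) (emb y) + gradInner (grad x) (grad y) := by
  change inner ℝ (x : Ambient) (y : Ambient) = _
  rw [WithLp.prod_inner_apply, PiLp.inner_apply]
  rfl

theorem norm_VSp_sq (x : VSp) :
    ‖x‖ ^ 2 = ‖emb x‖ ^ 2 + gradInner (grad x) (grad x) := by
  rw [← real_inner_self_eq_norm_sq, inner_VSp, real_inner_self_eq_norm_sq]

theorem gradInner_self (D : Fin 3 → L2) : gradInner D D = ∑ j, ‖D j‖ ^ 2 := by
  simp [gradInner]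

theorem norm_emb_le (x : VSp) : ‖emb x‖ ≤ ‖x‖ := by
  refine abs_le_of_sq_le_sq' ?_ (norm_nonneg _) |>.2
  rw [norm_VSp_sq, gradInner_self]
  have : 0 ≤ ∑ j, ‖grad x j‖ ^ 2 := by positivity
  linarith

theorem norm_grad_le (x : VSp) (j : Fin 3) : ‖grad x j‖ ≤ ‖x‖ := by
  refine abs_le_of_sq_le_sq' ?_ (norm_nonneg _) |>.2
  rw [norm_VSp_sq, gradInner_self]
  have := Finset.single_le_sum (f := fun j => ‖grad x j‖ ^ 2) (fun _ _ => by positivity)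
    (Finset.mem_univ j)
  linarith [sq_nonneg ‖emb x‖]

/-- The elements of `V` given by smooth solenoidal fields. -/
def testSet : Set VSp := {x | ∃ φ : E3 → E3, IsSolenoidalTest φ ∧ ⇑(emb x) =ᵐ[volume] φ ∧
  ∀ j, ⇑(grad x j) =ᵐ[volume] pderiv φ j}

/-- The smooth solenoidal fields are dense in `V`. -/
theorem dense_testSet (x : VSp) : ∃ y : ℕ → VSp, (∀ n, y n ∈ testSet) ∧
    Filter.Tendsto y Filter.atTop (nhds x) := by
  have hx : ambientEquiv x ∈ closure (testGraph : Set (L2 × (Fin 3 → L2))) := x.2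
  obtain ⟨p, hp, hlim⟩ := mem_closure_iff_seq_limit.1 hx
  refine ⟨fun n => toVSp (p n) (testGraph_subset_V (hp n)), fun n => ?_, ?_⟩
  · obtain ⟨φ, h1, h2, h3⟩ := hp n
    exact ⟨φ, h1, by simpa using h2, by simpa using h3⟩
  · rw [tendsto_subtype_rng]
    have := (ambientEquiv.symm.continuous.tendsto _).comp hlim
    rw [ContinuousLinearEquiv.symm_apply_apply] at this
    exact this

theorem closure_range_emb : closure (range emb) = H := by
  apply subset_antisymm
  · refine closure_minimal ?_ isClosed_closure
    rintro _ ⟨x, rfl⟩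
    obtain ⟨y, hy, hlim⟩ := dense_testSet x
    refine mem_closure_of_tendsto ((emb.continuous.tendsto x).comp hlim)
      (Filter.Eventually.of_forall fun n => ?_)
    obtain ⟨φ, h1, h2, -⟩ := hy n
    exact ⟨φ, h1, h2⟩
  · refine closure_mono ?_
    rintro f ⟨φ, hφ, hf⟩
    have hm : ∀ j, MemLp (pderiv φ j) 2 (volume : Measure E3) := by
      intro j
      have hc : Continuous (pderiv φ j) :=
        (hφ.smooth.continuous_fderiv (by simp)).clm_apply continuous_const
      refine hc.memLp_of_hasCompactSupport ?_
      exact (hφ.compactSupport.fderiv (𝕜 := ℝ)).comp_left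
        (g := fun L : E3 →L[ℝ] E3 => L (EuclideanSpace.single j 1)) (by simp)
    have hp : (f, fun j => (hm j).toLp _) ∈ testGraph :=
      ⟨φ, hφ, hf, fun j => (hm j).coeFn_toLp⟩
    exact ⟨toVSp _ (testGraph_subset_V hp), by simp⟩

open scoped ENNReal NNReal

/-! ### The convection form on `V` -/

theorem norm_fderiv_le_sum_pderiv (φ : E3 → E3) (x : E3) :
    ‖fderiv ℝ φ x‖ ≤ ∑ j, ‖pderiv φ j x‖ := by
  refine ContinuousLinearMap.opNorm_le_bound _ (by positivity) fun v => ?_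
  have hv : v = ∑ j, v j • EuclideanSpace.single j (1 : ℝ) := by
    have := (EuclideanSpace.basisFun (Fin 3) ℝ).sum_repr v
    simpa using this.symm
  calc ‖fderiv ℝ φ x v‖ = ‖∑ j, v j • pderiv φ j x‖ := by
        conv_lhs => rw [hv]
        simp [pderiv]
    _ ≤ ∑ j, ‖v j • pderiv φ j x‖ := norm_sum_le _ _
    _ ≤ ∑ j, ‖pderiv φ j x‖ * ‖v‖ := by
        refine Finset.sum_le_sum fun j _ => ?_
        rw [norm_smul, mul_comm]
        gcongr
        exact PiLp.norm_apply_le v j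
    _ = _ := by rw [Finset.sum_mul]

/-- The Sobolev inequality on `V`; it passes from smooth fields to their limits by Fatou's lemma. -/
theorem exists_eLpNorm_six_le : ∃ S : ℝ≥0, ∀ x : VSp,
    eLpNorm (emb x) 6 volume ≤ ENNReal.ofReal (S * ‖x‖) := by
  set S₀ : ℝ≥0 := SNormLESNormFDerivOfEqConst E3 (volume : Measure E3) 2 with hS₀
  have htest : ∀ x ∈ testSet, eLpNorm (emb x) 6 volume ≤ ENNReal.ofReal ((S₀ * 3 : ℝ≥0) * ‖x‖) := by
    rintro x ⟨φ, hφ, h1, h2⟩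
    have hsob : eLpNorm φ (6 : ℝ≥0) volume ≤ S₀ * eLpNorm (fderiv ℝ φ) (2 : ℝ≥0) volume := by
      refine eLpNorm_le_eLpNorm_fderiv_of_eq (volume : Measure E3)
        (hφ.smooth.of_le (by simp)) hφ.compactSupport (p := 2) (p' := 6)
        (by norm_num) (by simp) ?_
      simp; norm_num
    rw [eLpNorm_congr_ae h1]
    have h6 : ((6 : ℝ≥0) : ℝ≥0∞) = 6 := by norm_num
    have h22 : ((2 : ℝ≥0) : ℝ≥0∞) = 2 := by norm_num
    rw [h6, h22] at hsob
    refine hsob.trans ?_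
    have hm : ∀ j, AEStronglyMeasurable (fun y => ‖pderiv φ j y‖) (volume : Measure E3) := fun j =>
      ((Lp.aestronglyMeasurable (grad x j)).congr (h2 j)).norm
    have hfd : eLpNorm (fderiv ℝ φ) 2 volume ≤ ENNReal.ofReal (3 * ‖x‖) := by
      calc _ ≤ eLpNorm (∑ j, fun y => ‖pderiv φ j y‖) 2 (volume : Measure E3) := by
            refine eLpNorm_mono_real fun y => ?_
            simpa using norm_fderiv_le_sum_pderiv φ y
        _ ≤ ∑ j, eLpNorm (fun y => ‖pderiv φ j y‖) 2 (volume : Measure E3) :=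
            eLpNorm_sum_le (fun j _ => hm j) (by norm_num)
        _ ≤ ∑ j : Fin 3, ENNReal.ofReal ‖x‖ := by
            refine Finset.sum_le_sum fun j _ => ?_
            rw [eLpNorm_norm, ← eLpNorm_congr_ae (h2 j), ← Lp.enorm_def, ← ofReal_norm]
            exact ENNReal.ofReal_le_ofReal (norm_grad_le x j)
        _ = _ := by
            simp [ENNReal.ofReal_mul]
    calc _ ≤ (S₀ : ℝ≥0∞) * ENNReal.ofReal (3 * ‖x‖) := by gcongr
      _ = _ := by
        rw [← ENNReal.ofReal_coe_nnreal, ← ENNReal.ofReal_mul (by positivity)]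
        congr 1; push_cast; ring
  refine ⟨S₀ * 3, fun x => ?_⟩
  obtain ⟨y, hy, hlim⟩ := dense_testSet x
  obtain ⟨k, hk, hae⟩ := (tendstoInMeasure_of_tendsto_Lp
    ((emb.continuous.tendsto x).comp hlim)).exists_seq_tendsto_ae
  refine ENNReal.le_of_forall_pos_le_add fun ε hε _ => ?_
  refine Lp.eLpNorm_le_of_ae_tendsto ?_ (fun n => Lp.aestronglyMeasurable (emb (y (k n)))) hae
  have hlim2 : Filter.Tendsto (fun n => ENNReal.ofReal ((S₀ * 3 : ℝ≥0) * ‖y (k n)‖)) Filter.atTop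
      (nhds (ENNReal.ofReal ((S₀ * 3 : ℝ≥0) * ‖x‖))) :=
    (ENNReal.continuous_ofReal.tendsto _).comp
      (((hlim.comp hk.tendsto_atTop).norm).const_mul _)
  have hlt : ENNReal.ofReal ((S₀ * 3 : ℝ≥0) * ‖x‖)
      < ENNReal.ofReal ((S₀ * 3 : ℝ≥0) * ‖x‖) + ε :=
    ENNReal.lt_add_right ENNReal.ofReal_ne_top (by simpa using hε.ne')
  filter_upwards [hlim2.eventually_lt_const hlt] with n hn
  exact (htest _ (hy _)).trans hn.le

/-- Hölder's inequality for `f ∈ L⁶`, `g ∈ L²` and `h ∈ L³`, the `L³` norm of `h` being interpolated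
between `L²` and `L⁶`. -/
theorem lintegral_mul_mul_le_L6_L2 {α : Type*} [MeasurableSpace α] {μ : Measure α}
    {f g h : α → ℝ≥0∞} (hf : AEMeasurable f μ) (hg : AEMeasurable g μ) (hh : AEMeasurable h μ) :
    ∫⁻ x, f x * g x * h x ∂μ ≤ (∫⁻ x, f x ^ (6 : ℝ) ∂μ) ^ (1 / 6 : ℝ)
      * (∫⁻ x, g x ^ (2 : ℝ) ∂μ) ^ (1 / 2 : ℝ)
      * ((∫⁻ x, h x ^ (2 : ℝ) ∂μ) ^ (1 / 4 : ℝ) * (∫⁻ x, h x ^ (6 : ℝ) ∂μ) ^ (1 / 12 : ℝ)) := by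
  have := ENNReal.lintegral_prod_norm_pow_le (μ := μ) Finset.univ
    (f := ![fun x => f x ^ (6 : ℝ), fun x => g x ^ (2 : ℝ), fun x => h x ^ (2 : ℝ),
      fun x => h x ^ (6 : ℝ)]) (p := ![1 / 6, 1 / 2, 1 / 4, 1 / 12])
    (by
      intro i _
      fin_cases i
      · exact hf.pow_const _
      · exact hg.pow_const _
      · exact hh.pow_const _
      · exact hh.pow_const _)
    (by simp [Fin.sum_univ_four]; norm_num)
    (by intro i _; fin_cases i <;> simp)
  simp only [Fin.prod_univ_four, Matrix.cons_val_zero, Matrix.cons_val_one, Matrix.cons_val] at this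
  rw [mul_assoc (_ * _)] at this
  refine le_trans (le_of_eq (lintegral_congr fun x => ?_)) this
  rw [mul_assoc (_ * _), ← ENNReal.rpow_mul, ← ENNReal.rpow_mul, ← ENNReal.rpow_mul,
    ← ENNReal.rpow_mul, ← ENNReal.rpow_add_of_nonneg _ _ (by norm_num) (by norm_num)]
  norm_num

/-- The summands of the convection form are integrable, with a bound of Hölder type. -/
theorem integrable_convTerm {a d c : E3 → E3} {A C₂ C₆ D : ℝ}
    (ha : AEStronglyMeasurable a volume) (hd : AEStronglyMeasurable d volume)
    (hc : AEStronglyMeasurable c volume) (hA0 : 0 ≤ A) (hC₂0 : 0 ≤ C₂) (hC₆0 : 0 ≤ C₆) (hD0 : 0 ≤ D)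
    (hA : eLpNorm a 6 volume ≤ ENNReal.ofReal A) (hD : eLpNorm d 2 volume ≤ ENNReal.ofReal D)
    (hC₂ : eLpNorm c 2 volume ≤ ENNReal.ofReal C₂) (hC₆ : eLpNorm c 6 volume ≤ ENNReal.ofReal C₆) :
    Integrable (fun x => ‖a x‖ * ‖d x‖ * ‖c x‖) volume ∧
      ∫ x, ‖a x‖ * ‖d x‖ * ‖c x‖ ≤ A * D * √(C₂ * C₆) := by
  have e6 : ∀ f : E3 → E3, eLpNorm f 6 volume = (∫⁻ x, ‖f x‖ₑ ^ (6 : ℝ)) ^ (1 / 6 : ℝ) := fun f => by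
    rw [eLpNorm_eq_lintegral_rpow_enorm_toReal (by norm_num) (by norm_num)]; simp
  have e2 : ∀ f : E3 → E3, eLpNorm f 2 volume = (∫⁻ x, ‖f x‖ₑ ^ (2 : ℝ)) ^ (1 / 2 : ℝ) := fun f => by
    rw [eLpNorm_eq_lintegral_rpow_enorm_toReal (by norm_num) (by norm_num)]; simp
  have hle : ∫⁻ x, ‖‖a x‖ * ‖d x‖ * ‖c x‖‖ₑ ≤ ENNReal.ofReal (A * D * √(C₂ * C₆)) := by
    calc _ = ∫⁻ x, ‖a x‖ₑ * ‖d x‖ₑ * ‖c x‖ₑ := by simp [enorm_mul]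
      _ ≤ _ := lintegral_mul_mul_le_L6_L2 ha.enorm hd.enorm hc.enorm
      _ = eLpNorm a 6 volume * eLpNorm d 2 volume
          * (eLpNorm c 2 volume * eLpNorm c 6 volume) ^ (1 / 2 : ℝ) := by
          rw [ENNReal.mul_rpow_of_nonneg _ _ (by norm_num)]
          simp only [e6, e2, ← ENNReal.rpow_mul]
          norm_num
      _ ≤ ENNReal.ofReal A * ENNReal.ofReal D
          * (ENNReal.ofReal C₂ * ENNReal.ofReal C₆) ^ (1 / 2 : ℝ) := by gcongr
      _ = _ := by
          rw [← ENNReal.ofReal_mul hC₂0, ENNReal.ofReal_rpow_of_nonneg (by positivity) (by norm_num),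
            ← ENNReal.ofReal_mul hA0, ← ENNReal.ofReal_mul (by positivity), Real.sqrt_eq_rpow]
  have hint : Integrable (fun x => ‖a x‖ * ‖d x‖ * ‖c x‖) volume :=
    ⟨(ha.norm.mul hd.norm).mul hc.norm, hle.trans_lt ENNReal.ofReal_lt_top⟩
  refine ⟨hint, ?_⟩
  rw [← ENNReal.ofReal_le_ofReal_iff (by positivity), ofReal_integral_eq_lintegral_ofReal hint
    (Filter.Eventually.of_forall fun x => by positivity)]
  refine le_trans (le_of_eq (lintegral_congr fun x => ?_)) hle
  rw [Real.enorm_eq_ofReal (by positivity)]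

theorem integrable_conv_summand (a c : VSp) (d : L2) (j : Fin 3) :
    Integrable (fun x => (emb a x) j * inner ℝ (d x) (emb c x)) volume := by
  obtain ⟨S, hS⟩ := exists_eLpNorm_six_le
  have h := (integrable_convTerm (Lp.aestronglyMeasurable (emb a)) (Lp.aestronglyMeasurable d)
    (Lp.aestronglyMeasurable (emb c)) (by positivity) (norm_nonneg (emb c)) (by positivity)
    (norm_nonneg d) (hS a) (by rw [← Lp.enorm_def, ← ofReal_norm])
    (by rw [← Lp.enorm_def, ← ofReal_norm]) (hS c)).1
  have hm : AEStronglyMeasurable (fun x => (emb a x) j) (volume : Measure E3) :=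
    (EuclideanSpace.proj (𝕜 := ℝ) j).continuous.comp_aestronglyMeasurable
      (Lp.aestronglyMeasurable (emb a))
  refine h.mono (hm.mul ((Lp.aestronglyMeasurable d).inner (Lp.aestronglyMeasurable (emb c)))) ?_
  refine Filter.Eventually.of_forall fun x => ?_
  rw [norm_mul, Real.norm_of_nonneg (r := ‖emb a x‖ * ‖d x‖ * ‖emb c x‖) (by positivity), mul_assoc]
  gcongr
  · exact PiLp.norm_apply_le _ j
  · exact norm_inner_le_norm _ _

theorem conv_eq_sum (a b c : VSp) :
    conv (emb a) (grad b) (emb c)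
      = ∑ j, ∫ x, (emb a x) j * inner ℝ (grad b j x) (emb c x) :=
  integral_finsetSum _ fun j _ => integrable_conv_summand a c (grad b j) j

/-- The convection form is bounded with an intermediate norm, half way between `L²` and `H¹`, of
the last or of the first argument. -/
theorem exists_conv_bound : ∃ C : ℝ, 0 ≤ C ∧ ∀ a b c : VSp,
    conv (emb a) (grad b) (emb c) ^ 2 ≤ C * ‖a‖ ^ 2 * ‖b‖ ^ 2 * (‖emb c‖ * ‖c‖) ∧
    conv (emb a) (grad b) (emb c) ^ 2 ≤ C * (‖emb a‖ * ‖a‖) * ‖b‖ ^ 2 * ‖c‖ ^ 2 := by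
  obtain ⟨S, hS⟩ := exists_eLpNorm_six_le
  have h2 : ∀ d : L2, eLpNorm d 2 volume ≤ ENNReal.ofReal ‖d‖ := fun d => by
    rw [← Lp.enorm_def, ← ofReal_norm]
  have key : ∀ (a b c : VSp) (B : ℝ), (∀ j, ∫ x, ‖emb a x‖ * ‖grad b j x‖ * ‖emb c x‖ ≤ B) →
      conv (emb a) (grad b) (emb c) ^ 2 ≤ 9 * B ^ 2 := by
    intro a b c B hB
    have : |conv (emb a) (grad b) (emb c)| ≤ 3 * B := by
      rw [conv_eq_sum]
      calc _ ≤ ∑ j, |∫ x, (emb a x) j * inner ℝ (grad b j x) (emb c x)| :=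
            Finset.abs_sum_le_sum_abs _ _
        _ ≤ ∑ j : Fin 3, B := by
            refine Finset.sum_le_sum fun j _ => ?_
            rw [← Real.norm_eq_abs]
            refine (norm_integral_le_of_norm_le (integrable_convTerm
              (Lp.aestronglyMeasurable (emb a)) (Lp.aestronglyMeasurable (grad b j))
              (Lp.aestronglyMeasurable (emb c)) (by positivity) (norm_nonneg (emb c))
              (by positivity) (norm_nonneg (grad b j)) (hS a) (h2 _) (h2 _) (hS c)).1
              (Filter.Eventually.of_forall fun x => ?_)).trans (hB j)
            rw [norm_mul, mul_assoc]
            gcongr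
            · exact PiLp.norm_apply_le _ j
            · exact norm_inner_le_norm _ _
        _ = 3 * B := by simp
    have h := pow_le_pow_left₀ (abs_nonneg _) this 2
    rw [sq_abs] at h
    linarith
  refine ⟨9 * (S : ℝ) ^ 3, by positivity, fun a b c => ⟨?_, ?_⟩⟩
  · refine (key a b c (S * ‖a‖ * ‖b‖ * √(‖emb c‖ * (S * ‖c‖))) fun j => ?_).trans (le_of_eq ?_)
    · refine (integrable_convTerm (Lp.aestronglyMeasurable (emb a))
        (Lp.aestronglyMeasurable (grad b j)) (Lp.aestronglyMeasurable (emb c)) (by positivity)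
        (norm_nonneg (emb c)) (by positivity) (norm_nonneg (grad b j)) (hS a) (h2 _) (h2 _)
        (hS c)).2.trans ?_
      gcongr
      exact norm_grad_le b j
    · rw [mul_pow, Real.sq_sqrt (by positivity)]; ring
  · refine (key a b c (S * ‖c‖ * ‖b‖ * √(‖emb a‖ * (S * ‖a‖))) fun j => ?_).trans (le_of_eq ?_)
    · have := (integrable_convTerm (Lp.aestronglyMeasurable (emb c))
        (Lp.aestronglyMeasurable (grad b j)) (Lp.aestronglyMeasurable (emb a)) (by positivity)
        (norm_nonneg (emb a)) (by positivity) (norm_nonneg (grad b j)) (hS c) (h2 _) (h2 _)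
        (hS a)).2
      refine le_trans (le_of_eq (integral_congr_ae (Filter.Eventually.of_forall fun x => ?_)))
        (this.trans ?_)
      · simp only; ring
      · gcongr
        exact norm_grad_le b j
    · rw [mul_pow, Real.sq_sqrt (by positivity)]; ring

/-- The convection form as a continuous trilinear form on `V`. -/
theorem exists_convForm : ∃ B : VSp →L[ℝ] VSp →L[ℝ] VSp →L[ℝ] ℝ, ∀ a b c,
    B a b c = conv (emb a) (grad b) (emb c) := by
  obtain ⟨C, hC0, hC⟩ := exists_conv_bound
  have hbound : ∀ a b c : VSp, ‖conv (emb a) (grad b) (emb c)‖ ≤ √C * ‖a‖ * ‖b‖ * ‖c‖ := by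
    intro a b c
    refine abs_le_of_sq_le_sq ?_ (by positivity)
    refine (hC a b c).1.trans ?_
    calc _ ≤ C * ‖a‖ ^ 2 * ‖b‖ ^ 2 * (‖c‖ * ‖c‖) := by gcongr; exact norm_emb_le c
      _ = _ := by rw [mul_pow, mul_pow, mul_pow, Real.sq_sqrt hC0]; ring
  let T : VSp → VSp → VSp →L[ℝ] ℝ := fun a b => LinearMap.mkContinuous
    { toFun := fun c => conv (emb a) (grad b) (emb c)
      map_add' := fun c c' => by
        simp only [conv_eq_sum, ← Finset.sum_add_distrib]
        refine Finset.sum_congr rfl fun j _ => ?_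
        rw [← integral_add (integrable_conv_summand a c _ j) (integrable_conv_summand a c' _ j)]
        refine integral_congr_ae ?_
        filter_upwards [Lp.coeFn_add (emb c) (emb c')] with x hx
        rw [map_add, hx, Pi.add_apply, inner_add_right, mul_add]
      map_smul' := fun r c => by
        simp only [conv_eq_sum, RingHom.id_apply, smul_eq_mul, Finset.mul_sum]
        refine Finset.sum_congr rfl fun j _ => ?_
        rw [← integral_const_mul]
        refine integral_congr_ae ?_
        filter_upwards [Lp.coeFn_smul r (emb c)] with x hx
        rw [map_smul, hx, Pi.smul_apply, real_inner_smul_right]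
        ring } (√C * ‖a‖ * ‖b‖) (hbound a b)
  have hT : ∀ a b c, T a b c = conv (emb a) (grad b) (emb c) := fun a b c => rfl
  refine ⟨LinearMap.mkContinuous₂ (LinearMap.mk₂ ℝ T ?_ ?_ ?_ ?_) (√C) fun a b => ?_, fun a b c => ?_⟩
  · intro a a' b
    ext c
    simp only [hT, add_apply, conv_eq_sum, ← Finset.sum_add_distrib]
    refine Finset.sum_congr rfl fun j _ => ?_
    rw [← integral_add (integrable_conv_summand a c _ j) (integrable_conv_summand a' c _ j)]
    refine integral_congr_ae ?_
    filter_upwards [Lp.coeFn_add (emb a) (emb a')] with x hx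
    rw [map_add, hx, Pi.add_apply, PiLp.add_apply, add_mul]
  · intro r a b
    ext c
    simp only [hT, smul_apply, conv_eq_sum, smul_eq_mul, Finset.mul_sum]
    refine Finset.sum_congr rfl fun j _ => ?_
    rw [← integral_const_mul]
    refine integral_congr_ae ?_
    filter_upwards [Lp.coeFn_smul r (emb a)] with x hx
    rw [map_smul, hx, Pi.smul_apply, PiLp.smul_apply, smul_eq_mul, mul_assoc]
  · intro a b b'
    ext c
    simp only [hT, add_apply, conv_eq_sum, ← Finset.sum_add_distrib]
    refine Finset.sum_congr rfl fun j _ => ?_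
    rw [← integral_add (integrable_conv_summand a c _ j) (integrable_conv_summand a c _ j)]
    refine integral_congr_ae ?_
    filter_upwards [Lp.coeFn_add (grad b j) (grad b' j)] with x hx
    rw [map_add, Pi.add_apply, hx, Pi.add_apply, inner_add_left, mul_add]
  · intro r a b
    ext c
    simp only [hT, smul_apply, conv_eq_sum, smul_eq_mul, Finset.mul_sum]
    refine Finset.sum_congr rfl fun j _ => ?_
    rw [← integral_const_mul]
    refine integral_congr_ae ?_
    filter_upwards [Lp.coeFn_smul r (grad b j)] with x hx
    rw [map_smul, Pi.smul_apply, hx, Pi.smul_apply, real_inner_smul_left]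
    ring
  · exact LinearMap.mkContinuous_norm_le _ (by positivity) (hbound a b)
  · rfl

/-! ### Weak formulations in time -/

/-- Integration by parts against a primitive, which is only absolutely continuous. -/
theorem integral_deriv_mul_primitive {T : ℝ} {G ψ : ℝ → ℝ}
    (hG : IntervalIntegrable G volume 0 T) (hψ : ContDiff ℝ 1 ψ) (hψT : ψ T = 0) :
    ∫ t in (0 : ℝ)..T, deriv ψ t * ∫ s in (0 : ℝ)..t, G s = -∫ t in (0 : ℝ)..T, ψ t * G t := by
  have hac : AbsolutelyContinuousOnInterval ψ 0 T :=
    hψ.contDiffOn.absolutelyContinuousOnInterval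
  have hΓ := hG.absolutelyContinuousOnInterval_intervalIntegral (c := 0) (by simp)
  have h := AbsolutelyContinuousOnInterval.integral_mul_deriv_eq_deriv_mul hac hΓ
  simp only [hψT, zero_mul, intervalIntegral.integral_same, mul_zero, sub_zero, zero_sub] at h
  have h2 : ∫ t in (0 : ℝ)..T, ψ t * deriv (fun t => ∫ s in (0 : ℝ)..t, G s) t
      = ∫ t in (0 : ℝ)..T, ψ t * G t := by
    refine intervalIntegral.integral_congr_ae ?_
    filter_upwards [hG.ae_hasDerivAt_integral] with t ht htm
    rw [(ht (uIoc_subset_uIcc htm) 0 (by simp)).deriv]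
  rw [← h2, h, neg_neg]

theorem weak_of_integrated {T c : ℝ} (hT : 0 ≤ T) {g G ψ : ℝ → ℝ}
    (hG : IntervalIntegrable G volume 0 T)
    (h : ∀ t ∈ Icc 0 T, g t + ∫ s in (0 : ℝ)..t, G s = c)
    (hψ : ContDiff ℝ 1 ψ) (hψT : ψ T = 0) :
    -(∫ t in (0 : ℝ)..T, deriv ψ t * g t) + ∫ t in (0 : ℝ)..T, ψ t * G t = ψ 0 * c := by
  have hψ' : Continuous (deriv ψ) := hψ.continuous_deriv le_rfl
  have hcont : ContinuousOn (fun t => ∫ s in (0 : ℝ)..t, G s) (uIcc 0 T) :=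
    intervalIntegral.continuousOn_primitive_interval' hG (by simp)
  have h1 : ∫ t in (0 : ℝ)..T, deriv ψ t * g t
      = ∫ t in (0 : ℝ)..T, (deriv ψ t * c - deriv ψ t * ∫ s in (0 : ℝ)..t, G s) := by
    refine intervalIntegral.integral_congr fun t ht => ?_
    rw [uIcc_of_le hT] at ht
    rw [← h t ht]; ring
  have i1 : IntervalIntegrable (fun t => deriv ψ t * c) volume 0 T :=
    (hψ'.mul continuous_const).intervalIntegrable _ _
  have i2 : IntervalIntegrable (fun t => deriv ψ t * ∫ s in (0 : ℝ)..t, G s) volume 0 T :=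
    (hψ'.continuousOn.mul hcont).intervalIntegrable
  rw [h1, intervalIntegral.integral_sub i1 i2, integral_deriv_mul_primitive hG hψ hψT,
    intervalIntegral.integral_mul_const, intervalIntegral.integral_deriv_eq_sub
      (fun t _ => (hψ.differentiable (by simp)) t) (hψ'.intervalIntegrable _ _), hψT]
  ring

theorem ae_integrated_of_weak {T c : ℝ} (hT : 0 < T) {g G : ℝ → ℝ}
    (hg : IntervalIntegrable g volume 0 T) (hG : IntervalIntegrable G volume 0 T)
    (h : ∀ ψ : ℝ → ℝ, ContDiff ℝ 1 ψ → ψ T = 0 →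
      -(∫ t in (0 : ℝ)..T, deriv ψ t * g t) + ∫ t in (0 : ℝ)..T, ψ t * G t = ψ 0 * c) :
    ∀ᵐ t ∂(volume.restrict (Ioo 0 T)), g t + ∫ s in (0 : ℝ)..t, G s = c := by
  have hcont : ContinuousOn (fun t => ∫ s in (0 : ℝ)..t, G s) (uIcc 0 T) :=
    intervalIntegral.continuousOn_primitive_interval' hG (by simp)
  have hf : IntervalIntegrable (fun t => g t + (∫ s in (0 : ℝ)..t, G s) - c) volume 0 T :=
    (hg.add hcont.intervalIntegrable).sub (by simp)
  have hfo : IntegrableOn (fun t => g t + (∫ s in (0 : ℝ)..t, G s) - c) (Ioo 0 T) volume :=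
    ((intervalIntegrable_iff_integrableOn_Ioc_of_le hT.le).1 hf).mono_set Ioo_subset_Ioc_self
  rw [ae_restrict_iff' measurableSet_Ioo]
  have key := isOpen_Ioo.ae_eq_zero_of_integral_contDiff_smul_eq_zero
    hfo.locallyIntegrableOn (fun θ hθ _ hsupp => ?_)
  · filter_upwards [key] with t ht htm
    linarith [ht htm]
  -- the admissible weight with derivative `θ`
  set ψ : ℝ → ℝ := fun t => ∫ s in T..t, θ s with hψ
  have hθc : Continuous θ := hθ.continuous
  have hd : deriv ψ = θ := funext fun t => (hθc.integral_hasStrictDerivAt T t).hasDerivAt.deriv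
  have hψ1 : ContDiff ℝ 1 ψ := by
    rw [contDiff_one_iff_deriv, hd]
    exact ⟨fun t => (hθc.integral_hasStrictDerivAt T t).hasDerivAt.differentiableAt, hθc⟩
  have hψT : ψ T = 0 := by simp [hψ]
  have e1 := h ψ hψ1 hψT
  have e2 := integral_deriv_mul_primitive hG hψ1 hψT
  have e3 : ψ 0 = -∫ s in (0 : ℝ)..T, θ s := intervalIntegral.integral_symm _ _
  rw [hd] at e1 e2
  rw [← setIntegral_eq_integral_of_forall_compl_eq_zero (s := Ioc 0 T),
    ← intervalIntegral.integral_of_le hT.le]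
  · have e4 : ∫ t in (0 : ℝ)..T, θ t • (g t + (∫ s in (0 : ℝ)..t, G s) - c)
        = (∫ t in (0 : ℝ)..T, θ t * g t) + (∫ t in (0 : ℝ)..T, θ t * ∫ s in (0 : ℝ)..t, G s)
          - (∫ t in (0 : ℝ)..T, θ t) * c := by
      have i1 : IntervalIntegrable (fun t => θ t * g t) volume 0 T :=
        hg.continuousOn_mul hθc.continuousOn
      have i2 : IntervalIntegrable (fun t => θ t * ∫ s in (0 : ℝ)..t, G s) volume 0 T :=
        (hθc.continuousOn.mul hcont).intervalIntegrable
      have i3 : IntervalIntegrable (fun t => θ t * c) volume 0 T :=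
        (hθc.mul continuous_const).intervalIntegrable _ _
      rw [← intervalIntegral.integral_mul_const, ← intervalIntegral.integral_add i1 i2,
        ← intervalIntegral.integral_sub (i1.add i2) i3]
      refine intervalIntegral.integral_congr fun t _ => ?_
      simp only [smul_eq_mul]; ring
    rw [e4, e2]
    rw [e3] at e1
    linarith
  · intro t ht
    have : θ t = 0 := by
      by_contra hne
      exact ht (Ioo_subset_Ioc_self (hsupp (subset_tsupport _ hne)))
    rw [this, zero_smul]

/-! ### The dissipation of a Leray–Hopf solution with initial value in `V` -/

/-- The projection of `L² × (L²)³` onto `V`. -/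
def projV : L2 × (Fin 3 → L2) →L[ℝ] VSp :=
  VSub.orthogonalProjectionOnto ∘L (ambientEquiv.symm : L2 × (Fin 3 → L2) →L[ℝ] Ambient)

theorem projV_of_mem {p : L2 × (Fin 3 → L2)} (hp : p ∈ V) : projV p = toVSp p hp :=
  Submodule.orthogonalProjectionOnto_mem_subspace_eq_self (K := VSub) (toVSp p hp)

/-- A Leray–Hopf solution as a square integrable function with values in the Hilbert space `V`. -/
theorem IsLerayHopfNS.exists_lift {T : ℝ} {u₀ : L2} {u : ℝ → L2} {Du : ℝ → Fin 3 → L2}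
    (hu : IsLerayHopfNS T u₀ u Du) : ∃ U : ℝ → VSp, MemLp U 2 (volume.restrict (Ioc 0 T)) ∧
      ∀ᵐ t ∂(volume.restrict (Ioc 0 T)), emb (U t) = u t ∧ grad (U t) = Du t := by
  refine ⟨fun t => projV (u t, Du t), ?_, ?_⟩
  · rw [← restrict_Ioo_eq_restrict_Ioc]
    have h1 : MemLp u 2 (volume.restrict (Ioo 0 T)) := hu.memLp_top.mono_exponent le_top
    have h2 := ((projV ∘L ContinuousLinearMap.inl ℝ L2 (Fin 3 → L2)).comp_memLp' h1).add
      ((projV ∘L ContinuousLinearMap.inr ℝ L2 (Fin 3 → L2)).comp_memLp' hu.memLp_grad)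
    refine h2.ae_eq (Filter.Eventually.of_forall fun t => ?_)
    simp [← map_add]
  · rw [← restrict_Ioo_eq_restrict_Ioc]
    filter_upwards [hu.mem_V] with t ht
    simp [projV_of_mem ht]

/-- The convection form tested with a fixed field, after Young's inequality for the exponents
`4/3` and `4`. -/
theorem abs_convForm_le {C m : ℝ} (hC0 : 0 ≤ C) (hm : 0 ≤ m) {a c : VSp}
    (hC : conv (emb a) (grad a) (emb c) ^ 2 ≤ C * (‖emb a‖ * ‖a‖) * ‖a‖ ^ 2 * ‖c‖ ^ 2)
    (ha : ‖emb a‖ ≤ m) :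
    |conv (emb a) (grad a) (emb c)| ≤ 1 / 4 * ‖a‖ ^ 2 + 8 * (C * m * ‖c‖ ^ 2) ^ 2 := by
  set k := C * m * ‖c‖ ^ 2 with hk
  have hk0 : 0 ≤ k := by positivity
  refine abs_le_of_sq_le_sq ?_ (by positivity)
  calc _ ≤ C * (m * ‖a‖) * ‖a‖ ^ 2 * ‖c‖ ^ 2 := hC.trans (by gcongr)
    _ = ‖a‖ ^ 2 * (k * ‖a‖) := by rw [hk]; ring
    _ ≤ ‖a‖ ^ 2 * (1 / 16 * ‖a‖ ^ 2 + 4 * k ^ 2) := by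
        gcongr
        nlinarith [sq_nonneg (‖a‖ - 8 * k)]
    _ ≤ _ := by nlinarith [sq_nonneg ‖a‖, sq_nonneg k, mul_nonneg (sq_nonneg k) (sq_nonneg k)]

/-- For a Leray–Hopf solution, the velocity tested with a smooth solenoidal field satisfies the
time-integrated equation. -/
theorem IsLerayHopfNS.ae_integrated {T : ℝ} (hT : 0 < T) {u₀ : L2} {u : ℝ → L2}
    {Du : ℝ → Fin 3 → L2} (hu : IsLerayHopfNS T u₀ u Du) {U : ℝ → VSp}
    (hU : MemLp U 2 (volume.restrict (Ioc 0 T)))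
    (hUu : ∀ᵐ t ∂(volume.restrict (Ioc 0 T)), emb (U t) = u t ∧ grad (U t) = Du t)
    {v : VSp} (hv : v ∈ testSet) :
    IntervalIntegrable (fun s => gradInner (grad (U s)) (grad v)
        + conv (emb (U s)) (grad (U s)) (emb v)) volume 0 T ∧
    ∀ᵐ t ∂(volume.restrict (Ioo 0 T)), inner ℝ (u t) (emb v)
      + (∫ s in (0 : ℝ)..t, (gradInner (grad (U s)) (grad v)
        + conv (emb (U s)) (grad (U s)) (emb v))) = inner ℝ u₀ (emb v) := by
  obtain ⟨B, hB⟩ := exists_convForm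
  have hii : ∀ {f : ℝ → ℝ}, Integrable f (volume.restrict (Ioc 0 T)) →
      IntervalIntegrable f volume 0 T := fun hf =>
    (intervalIntegrable_iff_integrableOn_Ioc_of_le hT.le).2 hf
  have hUi : Integrable U (volume.restrict (Ioc 0 T)) := hU.integrable (by norm_num)
  have hI1 : IntervalIntegrable (fun s => gradInner (grad (U s)) (grad v)) volume 0 T := by
    have e : ∀ s, gradInner (grad (U s)) (grad v) = inner ℝ v (U s) - inner ℝ (emb v) (emb (U s)) :=
      fun s => by rw [real_inner_comm, inner_VSp, real_inner_comm (emb v)]; ring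
    simp_rw [e]
    exact hii ((hUi.const_inner v).sub ((emb.integrable_comp hUi).const_inner (emb v)))
  have hI2 : IntervalIntegrable (fun s => conv (emb (U s)) (grad (U s)) (emb v)) volume 0 T := by
    simp_rw [← hB]
    refine hii (((hU.integrable_norm_pow (by norm_num)).const_mul (‖B‖ * ‖v‖)).mono' ?_
      (Filter.Eventually.of_forall fun s => ?_))
    · have hc : Continuous fun x : VSp => B x x v := by fun_prop
      exact hc.comp_aestronglyMeasurable hU.1
    · calc ‖B (U s) (U s) v‖ ≤ ‖B (U s) (U s)‖ * ‖v‖ := (B (U s) (U s)).le_opNorm v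
        _ ≤ ‖B‖ * ‖U s‖ * ‖U s‖ * ‖v‖ := by gcongr; exact B.le_opNorm₂ _ _
        _ = _ := by ring
  have hI0 : IntervalIntegrable (fun s => inner ℝ (u s) (emb v)) volume 0 T := by
    refine hii (((emb.integrable_comp hUi).const_inner (emb v)).congr ?_)
    filter_upwards [hUu] with s hs
    rw [hs.1, real_inner_comm]
  refine ⟨hI1.add hI2, ae_integrated_of_weak hT hI0 (hI1.add hI2) fun ψ hψ hψT => ?_⟩
  obtain ⟨φ, hφ, h1, h2⟩ := hv
  rw [← hu.weak (emb v) (grad v) φ hφ h1 h2 ψ hψ hψT, add_assoc]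
  have hUu' := (ae_restrict_iff' measurableSet_Ioc).1 hUu
  congr 1
  have i1 : IntervalIntegrable (fun t => ψ t * gradInner (grad (U t)) (grad v)) volume 0 T :=
    hI1.continuousOn_mul hψ.continuous.continuousOn
  have i2 : IntervalIntegrable (fun t => ψ t * conv (emb (U t)) (grad (U t)) (emb v)) volume 0 T :=
    hI2.continuousOn_mul hψ.continuous.continuousOn
  simp_rw [mul_add]
  rw [intervalIntegral.integral_add i1 i2]
  congr 1 <;>
  · refine intervalIntegral.integral_congr_ae ?_
    rw [uIoc_of_le hT.le]
    filter_upwards [hUu'] with t ht htm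
    obtain ⟨e1, e2⟩ := ht htm
    simp only [e1, e2]

/-- The dissipation over `(0, t)` of a Leray–Hopf solution starting from `V` is of order `t`. The
energy inequality bounds it by `(u₀ - u(t), u₀)`, which is computed by testing the equation with
`u₀` itself. -/
theorem IsLerayHopfNS.exists_dissipation_bound {T : ℝ} (hT : 0 < T) {u₀ : L2} {u : ℝ → L2}
    {Du : ℝ → Fin 3 → L2} (hu : IsLerayHopfNS T u₀ u Du) {v : VSp} (hv : emb v = u₀) {U : ℝ → VSp}
    (hU : MemLp U 2 (volume.restrict (Ioc 0 T)))
    (hUu : ∀ᵐ t ∂(volume.restrict (Ioc 0 T)), emb (U t) = u t ∧ grad (U t) = Du t) :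
    ∃ M : ℝ, 0 ≤ M ∧ ∀ᵐ t ∂(volume.restrict (Ioo 0 T)), ∫ s in (0 : ℝ)..t, ‖U s‖ ^ 2 ≤ M * t := by
  obtain ⟨C, hC0, hC⟩ := exists_conv_bound
  set m := (eLpNorm u ⊤ (volume.restrict (Ioo 0 T))).toReal with hm
  have hm0 : 0 ≤ m := ENNReal.toReal_nonneg
  have hum : ∀ᵐ t ∂(volume.restrict (Ioc 0 T)), ‖u t‖ ≤ m := by
    rw [← restrict_Ioo_eq_restrict_Ioc]
    filter_upwards [ae_le_eLpNormEssSup (f := u) (μ := volume.restrict (Ioo 0 T))] with t ht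
    rw [← eLpNorm_exponent_top] at ht
    rw [← toReal_enorm]
    exact ENNReal.toReal_mono hu.memLp_top.2.ne ht
  have hUsq : IntervalIntegrable (fun s => ‖U s‖ ^ 2) volume 0 T :=
    (intervalIntegrable_iff_integrableOn_Ioc_of_le hT.le).2
      (hU.integrable_norm_pow (by norm_num))
  have hUm : ∀ᵐ t ∂(volume.restrict (Ioc 0 T)), ‖emb (U t)‖ ≤ m := by
    filter_upwards [hUu, hum] with t h1 h2
    rw [h1.1]; exact h2
  obtain ⟨y, hy, hlim⟩ := dense_testSet v
  have hmono : ∀ {t : ℝ}, t ∈ Ioo 0 T → uIcc 0 t ⊆ uIcc 0 T := fun {t} ht => by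
    rw [uIcc_of_le ht.1.le, uIcc_of_le hT.le]; exact Icc_subset_Icc_right ht.2.le
  -- the bound for the tested increments of `u`
  obtain ⟨c, hc⟩ : ∃ c : VSp → ℝ, c = fun x => 4 * ‖x‖ ^ 2 + 8 * (C * m * ‖x‖ ^ 2) ^ 2 := ⟨_, rfl⟩
  have htested : ∀ n, ∀ᵐ t ∂(volume.restrict (Ioo 0 T)),
      inner ℝ (u₀ - u t) (emb (y n)) ≤ 1 / 2 * (∫ s in (0 : ℝ)..t, ‖U s‖ ^ 2) + c (y n) * t := by
    intro n
    obtain ⟨hI, hae⟩ := hu.ae_integrated hT hU hUu (hy n)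
    filter_upwards [hae, ae_restrict_mem measurableSet_Ioo] with t ht htm
    rw [inner_sub_left, ← ht, add_sub_cancel_left]
    have hUt := hUsq.mono_set (hmono htm)
    calc _ ≤ ∫ s in (0 : ℝ)..t, (1 / 2 * ‖U s‖ ^ 2 + c (y n)) := by
          refine intervalIntegral.integral_mono_ae_restrict htm.1.le (hI.mono_set (hmono htm))
            ((hUt.const_mul _).add intervalIntegrable_const) ?_
          have hr : ∀ᵐ s ∂(volume.restrict (Icc 0 t)), ‖emb (U s)‖ ≤ m := by
            rw [← Measure.restrict_congr_set Ioc_ae_eq_Icc]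
            exact ae_mono (Measure.restrict_mono (Ioc_subset_Ioc_right htm.2.le) le_rfl) hUm
          filter_upwards [hr] with s hs
          have e1 := (le_abs_self _).trans (abs_convForm_le hC0 hm0 (hC (U s) (U s) (y n)).2 hs)
          have e2 : gradInner (grad (U s)) (grad (y n)) ≤ 1 / 4 * ‖U s‖ ^ 2 + 4 * ‖y n‖ ^ 2 := by
            have h1 := inner_VSp (U s) (y n)
            have h2 := real_inner_le_norm (U s) (y n)
            have h3 := neg_le_of_abs_le (abs_real_inner_le_norm (emb (U s)) (emb (y n)))
            have h4 : ‖emb (U s)‖ * ‖emb (y n)‖ ≤ ‖U s‖ * ‖y n‖ := by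
              gcongr <;> exact norm_emb_le _
            nlinarith [sq_nonneg (‖U s‖ - 4 * ‖y n‖)]
          simp only [hc]
          linarith
      _ = _ := by
          rw [intervalIntegral.integral_add (hUt.const_mul _) intervalIntegrable_const,
            intervalIntegral.integral_const_mul, intervalIntegral.integral_const]
          rw [sub_zero, smul_eq_mul, mul_comm t]
  refine ⟨2 * (m ^ 2 + c v), by rw [hc]; positivity, ?_⟩
  filter_upwards [ae_all_iff.2 htested, hu.energy, ae_restrict_mem measurableSet_Ioo] with
    t ht hen htm
  have hUt := hUsq.mono_set (hmono htm)
  have hclim : Filter.Tendsto (fun n => c (y n)) Filter.atTop (nhds (c v)) := by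
    have hcc : Continuous c := by rw [hc]; fun_prop
    exact (hcc.tendsto v).comp hlim
  have hlim1 := le_of_tendsto_of_tendsto'
    ((tendsto_const_nhds (x := u₀ - u t)).inner ((emb.continuous.tendsto v).comp hlim))
    (tendsto_const_nhds.add (hclim.mul_const t)) ht
  rw [hv, inner_sub_left, real_inner_self_eq_norm_sq] at hlim1
  have hD : (∫ s in (0 : ℝ)..t, ‖U s‖ ^ 2)
      ≤ m ^ 2 * t + ∫ s in (0 : ℝ)..t, gradInner (Du s) (Du s) := by
    have hr : ∀ᵐ s ∂(volume.restrict (Ioc 0 t)),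
        ‖emb (U s)‖ ≤ m ∧ emb (U s) = u s ∧ grad (U s) = Du s :=
      ae_mono (Measure.restrict_mono (Ioc_subset_Ioc_right htm.2.le) le_rfl) (hUm.and hUu)
    have hemb : Integrable (fun s => ‖emb (U s)‖ ^ 2) (volume.restrict (Ioc 0 t)) :=
      (emb.comp_memLp' (hU.mono_measure
        (Measure.restrict_mono (Ioc_subset_Ioc_right htm.2.le) le_rfl))).integrable_norm_pow
        (by norm_num)
    have hgi : IntervalIntegrable (fun s => gradInner (Du s) (Du s)) volume 0 t := by
      rw [intervalIntegrable_iff_integrableOn_Ioc_of_le htm.1.le]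
      refine (((intervalIntegrable_iff_integrableOn_Ioc_of_le htm.1.le).1 hUt).sub hemb).congr ?_
      filter_upwards [hr] with s hs
      simp only [Pi.sub_apply]
      rw [norm_VSp_sq, hs.2.2]; ring
    calc _ ≤ ∫ s in (0 : ℝ)..t, (m ^ 2 + gradInner (Du s) (Du s)) := by
          refine intervalIntegral.integral_mono_ae_restrict htm.1.le hUt
            (intervalIntegrable_const.add hgi) ?_
          rw [← Measure.restrict_congr_set Ioc_ae_eq_Icc]
          filter_upwards [hr] with s hs
          rw [norm_VSp_sq, hs.2.2]
          have := hs.1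
          gcongr
      _ = _ := by
          rw [intervalIntegral.integral_add intervalIntegrable_const hgi, intervalIntegral.integral_const]
          rw [sub_zero, smul_eq_mul, mul_comm t]
  have hyoung : inner ℝ (u t) u₀ ≤ 1 / 2 * ‖u t‖ ^ 2 + 1 / 2 * ‖u₀‖ ^ 2 := by
    linarith [real_inner_le_norm (u t) u₀, two_mul_le_add_sq ‖u t‖ ‖u₀‖]
  linarith

/-- The time averages of a Leray–Hopf solution starting from `V` are bounded in `V`, uniformly in
the length of the time interval. -/
theorem IsLerayHopfNS.exists_bounded_average {T : ℝ} (hT : 0 < T) {u₀ : L2}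
    (hu₀ : ∃ Du₀ : Fin 3 → L2, (u₀, Du₀) ∈ V) {u : ℝ → L2} {Du : ℝ → Fin 3 → L2}
    (hu : IsLerayHopfNS T u₀ u Du) : ∃ M : ℝ, 0 ≤ M ∧ ∀ δ, 0 < δ → δ ≤ T / 2 →
      ∃ b : VSp, ‖b‖ ^ 2 ≤ M ∧ emb b = timeAvg δ u ∧ grad b = timeAvg δ Du := by
  obtain ⟨Du₀, hDu₀⟩ := hu₀
  obtain ⟨U, hU, hUu⟩ := hu.exists_lift
  obtain ⟨M, hM0, hM⟩ := hu.exists_dissipation_bound hT (v := toVSp _ hDu₀) (by simp) hU hUu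
  refine ⟨2 * M, by positivity, fun δ hδ0 hδ => ?_⟩
  have hsub : volume.restrict (Ioc 0 δ) ≤ volume.restrict (Ioc 0 T) :=
    Measure.restrict_mono (Ioc_subset_Ioc_right (by linarith)) le_rfl
  have hUδ : MemLp U 2 (volume.restrict (Ioc 0 δ)) := hU.mono_measure hsub
  have hUi : IntervalIntegrable U volume 0 δ :=
    (intervalIntegrable_iff_integrableOn_Ioc_of_le hδ0.le).2 (hUδ.integrable (by norm_num))
  have hUuδ := (ae_restrict_iff' measurableSet_Ioc).1 (ae_mono hsub hUu)
  refine ⟨timeAvg δ U, ?_, ?_, ?_⟩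
  · -- a time between `δ` and `2 δ` at which the dissipation bound holds
    have hpos : volume (Ioo δ (2 * δ)) ≠ 0 := by simp; linarith
    obtain ⟨t, htm, ht⟩ : ∃ t ∈ Ioo δ (2 * δ), ∫ s in (0 : ℝ)..t, ‖U s‖ ^ 2 ≤ M * t := by
      by_contra! hcon
      refine hpos (measure_mono_null (fun t ht => ?_) ((ae_restrict_iff' measurableSet_Ioo).1 hM))
      simp only [mem_compl_iff, mem_ofPred_eq, Classical.not_imp, not_le]
      exact ⟨⟨hδ0.trans ht.1, ht.2.trans_le (by linarith)⟩, hcon t ht⟩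
    have hle : (∫ s in (0 : ℝ)..δ, ‖U s‖ ^ 2) ≤ ∫ s in (0 : ℝ)..t, ‖U s‖ ^ 2 := by
      refine intervalIntegral.integral_mono_interval le_rfl hδ0.le htm.1.le
        (Filter.Eventually.of_forall fun s => by positivity) ?_
      rw [intervalIntegrable_iff_integrableOn_Ioc_of_le (hδ0.trans htm.1).le]
      exact (hU.mono_measure (Measure.restrict_mono (Ioc_subset_Ioc_right
        (by linarith [htm.2])) le_rfl)).integrable_norm_pow (by norm_num)
    refine (norm_timeAvg_sq_le hδ0 hUδ).trans ?_
    rw [inv_mul_le_iff₀ hδ0]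
    nlinarith [htm.2]
  · rw [timeAvg, timeAvg, map_smul, ← emb.intervalIntegral_comp_comm hUi]
    congr 1
    refine intervalIntegral.integral_congr_ae ?_
    rw [uIoc_of_le hδ0.le]
    filter_upwards [hUuδ] with t ht htm using (ht htm).1
  · rw [timeAvg, timeAvg, map_smul, ← grad.intervalIntegral_comp_comm hUi]
    congr 1
    refine intervalIntegral.integral_congr_ae ?_
    rw [uIoc_of_le hδ0.le]
    filter_upwards [hUuδ] with t ht htm using (ht htm).2

/-! ### The auxiliary system -/

/-- The forcing of the auxiliary system, as an operator on `V`: by the Riesz representation,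
`(N a, v) = ((b · ∇) a, v) - ((a · ∇) b, v)`. -/
theorem exists_forcing_operator : ∃ C : ℝ, 0 ≤ C ∧ ∀ b : VSp, ∃ N : VSp →L[ℝ] VSp,
    (∀ a v, inner ℝ (N a) v
      = conv (emb b) (grad a) (emb v) - conv (emb a) (grad b) (emb v)) ∧
    ∀ a v, (inner ℝ (N a) v) ^ 2 ≤ C * ‖b‖ ^ 2 * ‖a‖ ^ 2 * (‖emb v‖ * ‖v‖) := by
  obtain ⟨B, hB⟩ := exists_convForm
  obtain ⟨C, hC0, hC⟩ := exists_conv_bound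
  refine ⟨4 * C, by positivity, fun b => ?_⟩
  let N : VSp →L[ℝ] VSp :=
    InnerProductSpace.continuousLinearMapOfBilin (𝕜 := ℝ) (B b - B.flip b)
  have hN : ∀ a v, inner ℝ (N a) v
      = conv (emb b) (grad a) (emb v) - conv (emb a) (grad b) (emb v) := fun a v => by
    rw [InnerProductSpace.continuousLinearMapOfBilin_apply, ← hB, ← hB]
    rfl
  refine ⟨N, hN, fun a v => ?_⟩
  rw [hN]
  have h1 := (hC b a v).1
  have h2 := (hC a b v).1
  nlinarith [sq_nonneg (conv (emb b) (grad a) (emb v) + conv (emb a) (grad b) (emb v))]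

/-- Solvability of the auxiliary system on `(0, δ)`, once `δ` is small compared with the size of the
forcing operator `N` of the averaged velocity `b = ū`. -/
theorem exists_isLerayHopfAux {u : ℝ → L2} {Du : ℝ → Fin 3 → L2} {δ K : ℝ} (hK : 0 ≤ K)
    (hδ0 : 0 < δ) (hδ : δ ≤ 1 / 12) (hKδ : 60 * (K * √δ) ≤ 1) {b : VSp}
    (hb : emb b = timeAvg δ u) (hDb : grad b = timeAvg δ Du) {N : VSp →L[ℝ] VSp}
    (hN : ∀ a v, inner ℝ (N a) v
      = conv (emb b) (grad a) (emb v) - conv (emb a) (grad b) (emb v))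
    (hNK : ∀ a v, (inner ℝ (N a) v) ^ 2 ≤ K * ‖a‖ ^ 2 * (‖emb v‖ * ‖v‖)) {w₀ : L2} (hw₀ : w₀ ∈ H) :
    ∃ (w : ℝ → L2) (Dw : ℝ → Fin 3 → L2), IsLerayHopfAux δ u Du w₀ w Dw := by
  rw [← closure_range_emb] at hw₀
  obtain ⟨w, Ω, hwc, hwH, ⟨R, hR⟩, hΩ, hwΩ, hw0, hweak, hen⟩ :=
    exists_energy_solution emb N hK hδ0 hδ hKδ hNK hw₀
  have hΩi : IntervalIntegrable Ω volume 0 δ :=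
    (intervalIntegrable_iff_integrableOn_Ioc_of_le hδ0.le).2 (hΩ.integrable (by norm_num))
  have hwΩ' := (ae_restrict_iff' measurableSet_Ioc).1 hwΩ
  have hwo : ∀ᵐ t ∂(volume.restrict (Ioo 0 δ)), w t = emb (Ω t) := by
    rwa [restrict_Ioo_eq_restrict_Ioc]
  have hav : timeAvg δ w = emb (timeAvg δ Ω) := by
    rw [timeAvg, timeAvg, map_smul, ← emb.intervalIntegral_comp_comm hΩi]
    congr 1
    refine intervalIntegral.integral_congr_ae ?_
    rwa [uIoc_of_le hδ0.le]
  have hDav : timeAvg δ (fun t => grad (Ω t)) = grad (timeAvg δ Ω) := by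
    rw [timeAvg, timeAvg, map_smul, ← grad.intervalIntegral_comp_comm hΩi]
  refine ⟨w, fun t => grad (Ω t), ?_⟩
  refine
    { mem_H := fun t _ => by rw [← closure_range_emb]; exact hwH t
      memLp_top := memLp_top_of_bound hwc.aestronglyMeasurable R (Filter.Eventually.of_forall hR)
      memLp_grad := ?_
      mem_V := ?_
      weak := ?_
      weakly_continuous := fun h => (hwc.inner continuous_const).continuousOn
      initial := hw0
      energy := ?_ }
  · rw [restrict_Ioo_eq_restrict_Ioc]
    exact grad.comp_memLp' hΩ
  · filter_upwards [hwo] with t ht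
    rw [ht]
    exact emb_grad_mem_V (Ω t)
  · intro v Dv hv ψ hψ hψT
    rw [hav, hDav, ← hb, ← hDb]
    set x : VSp := toVSp (v, Dv) hv with hx
    have hxv : emb x = v := emb_toVSp _ hv
    have hxD : grad x = Dv := grad_toVSp _ hv
    set F : ℝ := conv (emb b) (grad (timeAvg δ Ω)) v - conv (emb (timeAvg δ Ω)) (grad b) v with hF
    have hFN : inner ℝ (N (timeAvg δ Ω)) x = F := by rw [hN, hxv]
    have hg : ∀ s, gradInner (grad (Ω s)) Dv
        = inner ℝ (Ω s) x - inner ℝ (emb (Ω s)) (emb x) := fun s => by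
      rw [inner_VSp, hxD]; ring
    have hgi : IntervalIntegrable (fun s => gradInner (grad (Ω s)) Dv) volume 0 δ := by
      rw [intervalIntegrable_iff_integrableOn_Ioc_of_le hδ0.le]
      have hΩi' : Integrable Ω (volume.restrict (Ioc 0 δ)) := hΩ.integrable (by norm_num)
      refine ((hΩi'.const_inner x).sub ((emb.integrable_comp hΩi').const_inner (emb x))).congr
        (Filter.Eventually.of_forall fun s => ?_)
      simp only [Pi.sub_apply]
      rw [hg, real_inner_comm, real_inner_comm (emb x)]
    have hGi : IntervalIntegrable (fun s => gradInner (grad (Ω s)) Dv + F) volume 0 δ :=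
      hgi.add intervalIntegrable_const
    have key := weak_of_integrated (c := inner ℝ w₀ v) (g := fun t => inner ℝ (w t) v) hδ0.le hGi
      (fun t ht => by
        have h1 := hweak t ht x
        rw [hFN, hxv] at h1
        have hsub : IntervalIntegrable (fun s => gradInner (grad (Ω s)) Dv) volume 0 t :=
          hgi.mono_set (by
            rw [uIcc_of_le ht.1, uIcc_of_le hδ0.le]; exact Icc_subset_Icc_right ht.2)
        rw [intervalIntegral.integral_add hsub intervalIntegrable_const,
          intervalIntegral.integral_const, sub_zero, smul_eq_mul, ← h1]
        simp only [hg, hxv]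
        ring) hψ hψT
    have hψc := hψ.continuous
    have i1 : IntervalIntegrable (fun t => ψ t * gradInner (grad (Ω t)) Dv) volume 0 δ :=
      hgi.continuousOn_mul hψc.continuousOn
    have i2 : IntervalIntegrable (fun t => ψ t * F) volume 0 δ :=
      (hψc.mul continuous_const).intervalIntegrable _ _
    simp_rw [mul_add] at key
    rw [intervalIntegral.integral_add i1 i2] at key
    simp only [intervalIntegral.integral_mul_const] at key ⊢
    rw [hF] at key
    linarith
  · intro t ht
    have h1 := hen t ht
    rw [hav, hDav, ← hb, ← hDb]
    have e1 : (∫ s in (0 : ℝ)..t, gradInner (grad (Ω s)) (grad (Ω s)))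
        = ∫ s in (0 : ℝ)..t, (‖Ω s‖ ^ 2 - ‖emb (Ω s)‖ ^ 2) := by
      refine intervalIntegral.integral_congr fun s _ => ?_
      rw [norm_VSp_sq]; ring
    have e2 : (∫ s in (0 : ℝ)..t, (conv (emb b) (grad (timeAvg δ Ω)) (w s)
          - conv (emb (timeAvg δ Ω)) (grad b) (w s)))
        = ∫ s in (0 : ℝ)..t, inner ℝ (N (timeAvg δ Ω)) (Ω s) := by
      refine intervalIntegral.integral_congr_ae ?_
      rw [uIoc_of_le ht.1]
      filter_upwards [hwΩ'] with s hs hsm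
      rw [hs ⟨hsm.1, hsm.2.trans ht.2⟩, hN]
    rw [e1, e2]
    exact h1

end NSAux

end

theorem mainTheorem2 (T : ℝ) (hT : 0 < T)
    (u₀ : NSAux.L2) (hu₀ : ∃ Du₀ : Fin 3 → NSAux.L2, (u₀, Du₀) ∈ NSAux.V)
    (u : ℝ → NSAux.L2) (Du : ℝ → Fin 3 → NSAux.L2)
    (hu : NSAux.IsLerayHopfNS T u₀ u Du) :
    ∃ η : ℝ, 0 < η ∧ η ≤ T ∧ ∀ δ : ℝ, 0 < δ → δ ≤ η → ∀ w₀ ∈ NSAux.H,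
      ∃ (w : ℝ → NSAux.L2) (Dw : ℝ → Fin 3 → NSAux.L2),
        NSAux.IsLerayHopfAux δ u Du w₀ w Dw := by
  obtain ⟨M, hM0, hM⟩ := hu.exists_bounded_average hT hu₀
  obtain ⟨C, hC0, hC⟩ := NSAux.exists_forcing_operator
  have hK0 : 0 ≤ C * M := mul_nonneg hC0 hM0
  set r : ℝ := 1 / (60 * (C * M) + 1) with hr
  have hr0 : 0 < r := by positivity
  refine ⟨min (T / 2) (min (1 / 12) (r ^ 2)), by positivity,
    (min_le_left _ _).trans (by linarith), fun δ hδ0 hδ w₀ hw₀ => ?_⟩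
  obtain ⟨hδ1, hδ2, hδ3⟩ : δ ≤ T / 2 ∧ δ ≤ 1 / 12 ∧ δ ≤ r ^ 2 := by
    simpa only [le_min_iff] using hδ
  obtain ⟨b, hbM, hb, hDb⟩ := hM δ hδ0 hδ1
  obtain ⟨N, hN, hNC⟩ := hC b
  refine NSAux.exists_isLerayHopfAux (K := C * M) hK0 hδ0 hδ2 ?_ hb hDb hN (fun a v => ?_) hw₀
  · have h1 : √δ ≤ r := (Real.sqrt_le_left hr0.le).2 hδ3
    calc 60 * (C * M * √δ) ≤ 60 * (C * M * r) := by gcongr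
      _ = 60 * (C * M) / (60 * (C * M) + 1) := by rw [hr]; ring
      _ ≤ 1 := by rw [div_le_one (by positivity)]; linarith
  · exact (hNC a v).trans (by gcongr)
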